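/- Let $a<b$, $T>0$, $1<\alpha\le 2$, and let $K_1,K_2\ge 0$ be constants with $K_1^2+K_2^2\neq 0$. Consider the two-sided space fractional diffusion problem $$\partial_t u=K_1\,{}_aD_x^\alpha u+K_2\,{}_xD_b^\alpha u+f\ \text{ in }(a,b)\times(0,T],\qquad u(x,0)=u_0(x),\qquad u(a,t)=\phi_a(t),\quad u(b,t)=\phi_b(t),$$ where $f$ is continuous on $[a,b]\times[0,T]$, $\phi_a\equiv 0$ if $K_1\ne 0$, $\phi_b\equiv 0$ if $K_2\neq 0$, and, with $n=\lfloor\alpha\rfloor+1$, $${}_aD_x^\alpha v(x)=\frac{1}{\Gamma(n-\alpha)}\frac{d^n}{dx^n}\int_a^x (x-s)^{n-\alpha-1}v(s)\,ds,\qquad {}_xD_b^\alpha v(x)=\frac{(-1)^n}{\Gamma(n-\alpha)}\frac{d^n}{dx^n}\int_x^b (s-x)^{n-\alpha-1}v(s)\,ds$$ are the Riemann–Liouville derivatives (for $\alpha=2$ both are $v''$). Let $u$ be a solution which is smooth in the following sense: let $\bar u$ be the extension of $u$ by zero in $x$ from $[a,b]$ to $\mathbb R$; if $K_1\ne0$ then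 $\bar u\in C^7((-\infty,b]\times[0,T])$, and if $K_2\neq0$ then $\bar u\in C^7([a,\infty)\times[0,T])$, jointly in $(x,t)$. For integers $M,N\ge1$ put $h=(b-a)/M$, $\tau=T/N$, $x_j=a+jh$, $t_n=n\tau$. Let $g_k$ be the coefficients of the power series of $(1-z)^\alpha$, let $$\mu_1=\tfrac{(1+\alpha)(2+\alpha)}{12},\quad \mu_0=-\tfrac{(\alpha-2)(\alpha+2)}{6},\quad \mu_{-1}=\tfrac{(\alpha-2)(\alpha-1)}{12},\quad b_2=\tfrac{4+\alpha-\alpha^2}{24},$$ $w_0=\mu_1g_0$, $w_1=\mu_0g_0+\mu_1g_1$, $w_k=\mu_1g_k+\mu_0g_{k-1}+\mu_{-1}g_{k-2}$ for $k\ge2$, and for a grid function $V=(V_j)_{0\le j\le M}$ and $1\le j\le M-1$ let $$P_xV_j=V_j+b_2(V_{j-1}-2V_j+V_{j+1}),\quad {}_LD_h^\alpha V_j=\frac1{h^\alpha}\sum_{k=0}^{j+1}w_kV_{j-k+1},\quad {}_RD_h^\alpha V_j=\frac1{h^\alpha}\sum_{k=0}^{M-j+1}w_kV_{j+k-1}.$$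 Then there is a constant $C$, independent of $M$, $N$ (hence of $h$, $\tau$) and of $n$, such that for all $M,N\ge1$ and every solution $(U_j^n)_{0\le j\le M,\,0\le n\le N}$ of the Crank–Nicolson quasi-compact scheme $$P_xU_j^{n+1}-\tfrac{K_1\tau}{2}\,{}_LD_h^\alpha U_j^{n+1}-\tfrac{K_2\tau}{2}\,{}_RD_h^\alpha U_j^{n+1}=P_xU_j^{n}+\tfrac{K_1\tau}{2}\,{}_LD_h^\alpha U_j^{n}+\tfrac{K_2\tau}{2}\,{}_RD_h^\alpha U_j^{n}+\tau P_xf(x_j,t_n+\tfrac{\tau}{2})$$ ($1\le j\le M-1$, $0\le n\le N-1$) with $U_j^0=u_0(x_j)$, $U_0^n=\phi_a(t_n)$, $U_M^n=\phi_b(t_n)$, one has $$\Big(h\sum_{j=1}^{M-1}\big(u(x_j,t_n)-U_j^n\big)^2\Big)^{1/2}\le C(\tau^2+h^4)\qquad\text{for all }1\le n\le N.$$ -/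

import Mathlib

open Set

noncomputable section

namespace CNQuasiCompact

/-- Left Riemann–Liouville derivative of order `α` with base point `a`:
`1/Γ(n-α) · dⁿ/dxⁿ ∫_a^x (x-s)^(n-α-1) v(s) ds`, where `n = ⌊α⌋ + 1`.
For `α = 2` this is the ordinary second derivative. -/
def leftRL (a α : ℝ) (v : ℝ → ℝ) (x : ℝ) : ℝ :=
  (Real.Gamma (((⌊α⌋₊ + 1 : ℕ) : ℝ) - α))⁻¹ *
    iteratedDeriv (⌊α⌋₊ + 1)
      (fun y => ∫ s in a..y, (y - s) ^ (((⌊α⌋₊ + 1 : ℕ) : ℝ) - α - 1) * v s) x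

/-- Right Riemann–Liouville derivative of order `α` with base point `b`:
`(-1)ⁿ/Γ(n-α) · dⁿ/dxⁿ ∫_x^b (s-x)^(n-α-1) v(s) ds`, where `n = ⌊α⌋ + 1`.
For `α = 2` this is the ordinary second derivative. -/
def rightRL (b α : ℝ) (v : ℝ → ℝ) (x : ℝ) : ℝ :=
  (-1) ^ (⌊α⌋₊ + 1) * (Real.Gamma (((⌊α⌋₊ + 1 : ℕ) : ℝ) - α))⁻¹ *
    iteratedDeriv (⌊α⌋₊ + 1)
      (fun y => ∫ s in y..b, (s - y) ^ (((⌊α⌋₊ + 1 : ℕ) : ℝ) - α - 1) * v s) x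

/-- `u` solves `u_t = K₁ ₐD_x^α u + K₂ ₓD_b^α u + f` on `(a,b) × (0,T]` with initial value `u₀`
and boundary values `φa`, `φb`. The time derivative at `t = T` is one-sided. -/
structure IsSolution (a b T α K₁ K₂ : ℝ) (f : ℝ → ℝ → ℝ) (u₀ φa φb : ℝ → ℝ)
    (u : ℝ → ℝ → ℝ) : Prop where
  equation : ∀ x ∈ Ioo a b, ∀ t ∈ Ioc 0 T,
    HasDerivWithinAt (fun s => u x s)
      (K₁ * leftRL a α (fun y => u y t) x + K₂ * rightRL b α (fun y => u y t) x + f x t)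
      (Icc 0 T) t
  initial : ∀ x ∈ Icc a b, u x 0 = u₀ x
  boundary_left : ∀ t ∈ Icc 0 T, u a t = φa t
  boundary_right : ∀ t ∈ Icc 0 T, u b t = φb t

/-- Extension of `u` by zero in the space variable from `[a,b]` to `ℝ`,
as a function of the pair `(x,t)`. -/
def zeroExt (a b : ℝ) (u : ℝ → ℝ → ℝ) (p : ℝ × ℝ) : ℝ :=
  (Icc a b).indicator (fun x => u x p.2) p.1

/-- `u` is sufficiently smooth: its extension by zero in space across each endpoint at which a
fractional derivative is based (`a` if `K₁ ≠ 0`, `b` if `K₂ ≠ 0`) is of class `C⁷` in `(x,t)`,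
for `t ∈ [0,T]`. If both coefficients are nonzero this is the class `C⁷` on `ℝ × [0,T]`. -/
structure IsSmoothSolution (a b T K₁ K₂ : ℝ) (u : ℝ → ℝ → ℝ) : Prop where
  left : K₁ ≠ 0 → ContDiffOn ℝ 7 (zeroExt a b u) (Iic b ×ˢ Icc 0 T)
  right : K₂ ≠ 0 → ContDiffOn ℝ 7 (zeroExt a b u) (Ici a ×ˢ Icc 0 T)

/-- Grünwald weights: the coefficients of the power series of `(1 - z)^α`. -/
def grunwald (α : ℝ) (k : ℕ) : ℝ := (-1) ^ k * Ring.choose α k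

def mu1 (α : ℝ) : ℝ := (1 + α) * (2 + α) / 12

def mu0 (α : ℝ) : ℝ := -((-2 + α) * (2 + α)) / 6

def muNeg1 (α : ℝ) : ℝ := (-2 + α) * (-1 + α) / 12

def b2 (α : ℝ) : ℝ := (4 + α - α ^ 2) / 24

/-- Weights of the weighted and shifted Grünwald operator. -/
def weight (α : ℝ) : ℕ → ℝ
  | 0 => mu1 α * grunwald α 0
  | 1 => mu0 α * grunwald α 0 + mu1 α * grunwald α 1
  | k + 2 => mu1 α * grunwald α (k + 2) + mu0 α * grunwald α (k + 1) + muNeg1 α * grunwald α k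

/-- Centered second difference; used at indices `j ≥ 1`. -/
def centeredDiff (h : ℝ) (U : ℕ → ℝ) (j : ℕ) : ℝ :=
  (U (j - 1) - 2 * U j + U (j + 1)) / h ^ 2

/-- The operator `P_x = 1 + h² b₂ δ_x²`; used at indices `j ≥ 1`. -/
def Px (α h : ℝ) (U : ℕ → ℝ) (j : ℕ) : ℝ :=
  U j + h ^ 2 * b2 α * centeredDiff h U j

/-- `h^(-α) ∑_{k=0}^{j+1} w_k U_{j-k+1}`. -/
def leftDiscrete (α h : ℝ) (U : ℕ → ℝ) (j : ℕ) : ℝ :=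
  1 / h ^ α * ∑ k ∈ Finset.range (j + 2), weight α k * U (j + 1 - k)

/-- `h^(-α) ∑_{k=0}^{M-j+1} w_k U_{j+k-1}`; used at indices `1 ≤ j ≤ M - 1`. -/
def rightDiscrete (α h : ℝ) (M : ℕ) (U : ℕ → ℝ) (j : ℕ) : ℝ :=
  1 / h ^ α * ∑ k ∈ Finset.range (M - j + 2), weight α k * U (j + k - 1)

/-- `U n j` solves the Crank–Nicolson quasi-compact scheme on the grid
`x_j = a + j h` (`0 ≤ j ≤ M`), `t_n = n τ` (`0 ≤ n ≤ N`), with `h = (b-a)/M` and `τ = T/N`. -/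
structure IsSchemeSolution (a b T α K₁ K₂ : ℝ) (f : ℝ → ℝ → ℝ) (u₀ φa φb : ℝ → ℝ)
    (M N : ℕ) (h τ : ℝ) (U : ℕ → ℕ → ℝ) : Prop where
  space_step : h = (b - a) / M
  time_step : τ = T / N
  equation : ∀ n, n < N → ∀ j, 1 ≤ j → j < M →
    Px α h (U (n + 1)) j - K₁ * τ / 2 * leftDiscrete α h (U (n + 1)) j
        - K₂ * τ / 2 * rightDiscrete α h M (U (n + 1)) j
      = Px α h (U n) j + K₁ * τ / 2 * leftDiscrete α h (U n) j
        + K₂ * τ / 2 * rightDiscrete α h M (U n) j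
        + τ * Px α h (fun i => f (a + i * h) ((n + 1 / 2) * τ)) j
  initial : ∀ j, j ≤ M → U 0 j = u₀ (a + j * h)
  boundary_left : ∀ n, n ≤ N → U n 0 = φa (n * τ)
  boundary_right : ∀ n, n ≤ N → U n M = φb (n * τ)

/-- Discrete `L²` norm: the square root of `h ∑_{j=1}^{M-1} v_j²`. -/
def discreteNorm (h : ℝ) (M : ℕ) (v : ℕ → ℝ) : ℝ :=
  Real.sqrt (h * ∑ j ∈ Finset.Ico 1 M, v j ^ 2)

end CNQuasiCompact

end

/-! ### Signs of the weights and negativity of their Toeplitz form. -/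

noncomputable section
namespace CNQuasiCompact

/-! Convergence is stability plus consistency.

Stability is an energy argument. For grid functions vanishing at both ends the form of the weights
is negative semidefinite (`leftForm_nonpos`), because `w_k ≥ 0` for `k ≥ 3`, `w_0 + w_2 ≥ 0`, and
partial sums of at least three weights are nonpositive. The operator `P_x` is symmetric and bounded
below by `1 - 4 b₂ ≥ 1/3`. Pairing the error equation with `e^(n+1) + e^n` shows that the square
root of the energy grows per step by at most the size of the residual (`sqrt_energy_step`).

Consistency in space is a Peano kernel argument. Since the zero extension of `u` is `C⁷` across the
base point, `u(·,t)` is the convolution of `∂ₓ⁷u` with `x₊⁶/6!`, and its Riemann–Liouville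
derivative is the convolution of `∂ₓ⁷u` with `x₊^(6-α)/Γ(7-α)`. By linearity it is enough to bound
one kernel, `kernelError`, by `O(h⁴)`. Laplace inversion on `Re s = 1` writes that kernel as the
integral of `h^(-α) e^(sy) s^(-7) symbol(hs)`. The values of the `μ` and of `b₂` make the symbol
`O(|z|^(α+4))` (`norm_symbol_le`), so the integrand is `O(h⁴ |s|^(α-3))`, which is integrable for `α
< 2`. For `α = 2` the kernel is piecewise polynomial and is estimated directly. The right operator
follows by reflection.

Consistency in time is the midpoint rule. For the fractional term the order-`(7-α)` integral of
`∂ₓ⁷u` is rewritten as the order-`(4-α)` integral of `∂ₓ⁴u`, which leaves two time derivatives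
within the `C⁷` assumption. -/

theorem grunwald_zero (α : ℝ) : grunwald α 0 = 1 := by
  simp [grunwald]

/-- The signs, sizes and partial sums of the coefficients below are all read off from this
recurrence. -/
theorem grunwald_succ (α : ℝ) (k : ℕ) :
    ((k : ℝ) + 1) * grunwald α (k + 1) = (k - α) * grunwald α k := by
  have h1 : ((k : ℝ) + 1) ≠ 0 := by positivity
  have h2 : ((k.factorial : ℕ) : ℝ) ≠ 0 := by positivity
  simp only [grunwald, Ring.choose_eq_smul, descPochhammer_succ_right, Nat.factorial_succ,
    Polynomial.smeval_mul, Polynomial.smeval_sub, Polynomial.smeval_X, Polynomial.smeval_natCast,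
    smul_eq_mul]
  push_cast
  field_simp
  simp
  ring

theorem grunwald_one (α : ℝ) : grunwald α 1 = -α := by
  have := grunwald_succ α 0
  simpa [grunwald_zero] using this

theorem grunwald_two (α : ℝ) : grunwald α 2 = α * (α - 1) / 2 := by
  have := grunwald_succ α 1
  rw [grunwald_one] at this
  norm_num at this
  linarith

theorem grunwald_nonneg {α : ℝ} (hα : 1 < α) (hα' : α ≤ 2) (k : ℕ) :
    0 ≤ grunwald α (k + 2) := by
  induction k with
  | zero =>
    rw [grunwald_two]
    nlinarith
  | succ k ih =>
    have := grunwald_succ α (k + 2)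
    push_cast at this
    have h1 : 0 ≤ ((k : ℝ) + 2 - α) * grunwald α (k + 2) :=
      mul_nonneg (by have := Nat.cast_nonneg (α := ℝ) k; linarith) ih
    rw [← this] at h1
    exact nonneg_of_mul_nonneg_right h1 (by positivity)

/-- The partial sums are the coefficients of `(1-z)^(α-1)`, and the derivative of `(1-z)^α` is `-α
(1-z)^(α-1)`. -/
theorem sum_grunwald (α : ℝ) (k : ℕ) :
    α * ∑ i ∈ Finset.range (k + 1), grunwald α i = -((k + 1) * grunwald α (k + 1)) := by
  induction k with
  | zero => simp [grunwald_zero, grunwald_one]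
  | succ k ih =>
    rw [Finset.sum_range_succ, mul_add, ih]
    have := grunwald_succ α (k + 1)
    push_cast at this ⊢
    linarith

theorem mu1_nonneg {α : ℝ} (hα : 1 < α) : 0 ≤ mu1 α := by
  unfold mu1; positivity

theorem mu0_nonneg {α : ℝ} (hα : 1 < α) (hα' : α ≤ 2) : 0 ≤ mu0 α := by
  unfold mu0; nlinarith

theorem muNeg1_nonpos {α : ℝ} (hα : 1 < α) (hα' : α ≤ 2) : muNeg1 α ≤ 0 := by
  unfold muNeg1; nlinarith

/-- For `α` near `1` the weight `w_2` is negative, so only the sum has a sign. That suffices, since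
both weights multiply the same lag-one correlation in `leftForm_nonpos`. -/
theorem weight_zero_add_two_nonneg {α : ℝ} (hα : 1 < α) (hα' : α ≤ 2) :
    0 ≤ weight α 0 + weight α 2 := by
  simp only [weight, zero_add, grunwald_zero, grunwald_one, grunwald_two, mu1, mu0, muNeg1]
  obtain ⟨x, rfl⟩ : ∃ x, α = 1 + x := ⟨α - 1, by ring⟩
  have hx : 0 < x := by linarith
  have hx1 : x ≤ 1 := by linarith
  have : 0 ≤ x * (1 - x) := mul_nonneg hx.le (by linarith)
  ring_nf
  nlinarith [mul_nonneg hx.le hx.le, mul_nonneg this hx.le, pow_pos hx 3, pow_pos hx 4]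

theorem weight_nonneg {α : ℝ} (hα : 1 < α) (hα' : α ≤ 2) (k : ℕ) :
    0 ≤ weight α (k + 3) := by
  -- `w_3` contains `g_1 = -α < 0`, to which `grunwald_nonneg` does not apply; there the sign of
  -- `muNeg1` compensates.
  rcases k with _ | m
  · have h1 : grunwald α 3 * 3 = (2 - α) * grunwald α 2 := by
      have := grunwald_succ α 2
      push_cast at this
      linarith
    have h2 := grunwald_nonneg hα hα' 0
    have h3 := grunwald_nonneg hα hα' 1
    simp only [weight, grunwald_one]
    have := mul_nonneg (mu1_nonneg hα) h3
    have := mul_nonneg (mu0_nonneg hα hα') h2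
    have := mul_nonneg_of_nonpos_of_nonpos (muNeg1_nonpos hα hα') (by linarith : -α ≤ 0)
    simp only [zero_add, Nat.reduceAdd] at *
    linarith
  · have h1 := grunwald_succ α (m + 2)
    have h2 := grunwald_succ α (m + 3)
    push_cast at h1 h2
    have hg := grunwald_nonneg hα hα' m
    have hm : (0 : ℝ) ≤ m := Nat.cast_nonneg m
    have key : ((m : ℝ) + 3) * (m + 4) * weight α (m + 1 + 3) = grunwald α (m + 2) *
        (mu1 α * (m + 3 - α) * (m + 2 - α) + mu0 α * (m + 2 - α) * (m + 4)
          + muNeg1 α * (m + 3) * (m + 4)) := by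
      simp only [weight]
      have e1 : ((m : ℝ) + 3) * grunwald α (m + 3) = (m + 2 - α) * grunwald α (m + 2) := by
        linarith
      have e2 : ((m : ℝ) + 4) * grunwald α (m + 4) = (m + 3 - α) * grunwald α (m + 3) := by
        linarith
      have e3 : ((m : ℝ) + 3) * (m + 4) * grunwald α (m + 4)
          = (m + 3 - α) * ((m + 2 - α) * grunwald α (m + 2)) := by
        rw [← e1]; linear_combination ((m : ℝ) + 3) * e2
      linear_combination mu1 α * e3 + mu0 α * (m + 4) * e1
    -- As a quadratic in `m` this has constant term `c0`, linear coefficient `c1` and leading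
    -- coefficient `1` by `c2`, all nonnegative.
    have q : 0 ≤ mu1 α * (m + 3 - α) * (m + 2 - α) + mu0 α * (m + 2 - α) * (m + 4)
          + muNeg1 α * (m + 3) * (m + 4) := by
      have c0 : 0 ≤ mu1 α * (3 - α) * (2 - α) + mu0 α * (2 - α) * 4 + muNeg1 α * 12 := by
        have : mu1 α * (3 - α) * (2 - α) + mu0 α * (2 - α) * 4 + muNeg1 α * 12
          = (2 - α) * ((1 + α) * (2 + α) * (3 - α) / 12 + 2 * (2 - α) * (2 + α) / 3
            - (α - 1)) := by unfold mu1 mu0 muNeg1; ring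
        rw [this]
        refine mul_nonneg (by linarith) ?_
        nlinarith [mul_nonneg (sub_nonneg.2 hα.le) (sub_nonneg.2 hα'),
          mul_nonneg (mul_nonneg (sub_nonneg.2 hα.le) (sub_nonneg.2 hα')) (sub_nonneg.2 hα.le)]
      have c1 : 0 ≤ mu1 α * (5 - 2 * α) + mu0 α * (6 - α) + muNeg1 α * 7 := by
        unfold mu1 mu0 muNeg1
        nlinarith [mul_nonneg (sub_nonneg.2 hα.le) (sub_nonneg.2 hα'),
          mul_nonneg (mul_nonneg (sub_nonneg.2 hα.le) (sub_nonneg.2 hα')) (sub_nonneg.2 hα.le)]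
      have c2 : mu1 α + mu0 α + muNeg1 α = 1 := by unfold mu1 mu0 muNeg1; ring
      nlinarith [mul_nonneg hm c1, mul_nonneg hm hm]
    have := mul_nonneg hg q
    rw [← key] at this
    exact nonneg_of_mul_nonneg_right this (by positivity)

theorem sum_weight (α : ℝ) (k : ℕ) :
    ∑ i ∈ Finset.range (k + 3), weight α i
      = mu1 α * ∑ i ∈ Finset.range (k + 3), grunwald α i
        + mu0 α * ∑ i ∈ Finset.range (k + 2), grunwald α i
        + muNeg1 α * ∑ i ∈ Finset.range (k + 1), grunwald α i := by
  induction k with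
  | zero => simp [Finset.sum_range_succ, weight]; ring
  | succ k ih =>
    rw [Finset.sum_range_succ, ih, Finset.sum_range_succ _ (k + 1 + 2),
      Finset.sum_range_succ _ (k + 1 + 1), Finset.sum_range_succ _ (k + 1)]
    simp only [weight]
    ring

/-- The sign is natural: the full series sums to `0` and the omitted weights are nonnegative. The
proof avoids the series: `sum_grunwald` turns the partial sums into a combination of terms `k g_k`,
and the quadratic argument of `weight_nonneg` is repeated. -/
theorem sum_weight_nonpos {α : ℝ} (hα : 1 < α) (hα' : α ≤ 2) (k : ℕ) :
    ∑ i ∈ Finset.range (k + 3), weight α i ≤ 0 := by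
  have hα0 : 0 < α := by linarith
  refine nonpos_of_mul_nonpos_right ?_ hα0
  have key : α * ∑ i ∈ Finset.range (k + 3), weight α i
      = -(mu1 α * ((k + 3) * grunwald α (k + 3)) + mu0 α * ((k + 2) * grunwald α (k + 2))
        + muNeg1 α * ((k + 1) * grunwald α (k + 1))) := by
    rw [sum_weight]
    have h1 := sum_grunwald α k
    have h2 := sum_grunwald α (k + 1)
    have h3 := sum_grunwald α (k + 2)
    push_cast at h1 h2 h3
    linear_combination mu1 α * h3 + mu0 α * h2 + muNeg1 α * h1
  rw [key, neg_nonpos]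
  rcases k with _ | m
  · have h1 : grunwald α 3 * 3 = (2 - α) * grunwald α 2 := by
      have := grunwald_succ α 2
      push_cast at this
      linarith
    have h2 := grunwald_nonneg hα hα' 0
    have h3 := grunwald_nonneg hα hα' 1
    simp only [zero_add, Nat.reduceAdd, grunwald_one] at *
    have := mul_nonneg (mu1_nonneg hα) h3
    have := mul_nonneg (mu0_nonneg hα hα') h2
    have := mul_nonneg_of_nonpos_of_nonpos (muNeg1_nonpos hα hα') (by linarith : -α ≤ 0)
    norm_num
    linarith
  · have h1 := grunwald_succ α (m + 2)
    have h2 := grunwald_succ α (m + 3)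
    push_cast at h1 h2 ⊢
    have hg := grunwald_nonneg hα hα' m
    have hm : (0 : ℝ) ≤ m := Nat.cast_nonneg m
    have e1 : ((m : ℝ) + 3) * grunwald α (m + 3) = (m + 2 - α) * grunwald α (m + 2) := by
      linarith
    have e2 : ((m : ℝ) + 4) * grunwald α (m + 4) = (m + 3 - α) * grunwald α (m + 3) := by
      linarith
    have key : ((m : ℝ) + 3) * (mu1 α * ((m + 1 + 3) * grunwald α (m + 1 + 3))
        + mu0 α * ((m + 1 + 2) * grunwald α (m + 1 + 2))
        + muNeg1 α * ((m + 1 + 1) * grunwald α (m + 1 + 1)))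
        = grunwald α (m + 2) *
        (mu1 α * (m + 3 - α) * (m + 2 - α) + mu0 α * (m + 2 - α) * (m + 3)
          + muNeg1 α * (m + 3) * (m + 2)) := by
      have e3 : ((m : ℝ) + 3) * ((m + 4) * grunwald α (m + 4))
          = (m + 3 - α) * ((m + 2 - α) * grunwald α (m + 2)) := by
        rw [← e1, e2]; ring
      linear_combination mu1 α * e3 + mu0 α * (m + 3) * e1
    have q : 0 ≤ mu1 α * (m + 3 - α) * (m + 2 - α) + mu0 α * (m + 2 - α) * (m + 3)
          + muNeg1 α * (m + 3) * (m + 2) := by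
      have c0 : 0 ≤ mu1 α * (3 - α) * (2 - α) + mu0 α * (2 - α) * 3 + muNeg1 α * 6 := by
        have : mu1 α * (3 - α) * (2 - α) + mu0 α * (2 - α) * 3 + muNeg1 α * 6
          = (2 - α) * ((1 + α) * (2 + α) * (3 - α) / 12 + (2 - α) * (2 + α) / 2
            - (α - 1) / 2) := by unfold mu1 mu0 muNeg1; ring
        rw [this]
        refine mul_nonneg (by linarith) ?_
        nlinarith [mul_nonneg (sub_nonneg.2 hα.le) (sub_nonneg.2 hα'),
          mul_nonneg (mul_nonneg (sub_nonneg.2 hα.le) (sub_nonneg.2 hα')) (sub_nonneg.2 hα.le)]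
      have c1 : 0 ≤ mu1 α * (5 - 2 * α) + mu0 α * (5 - α) + muNeg1 α * 5 := by
        unfold mu1 mu0 muNeg1
        nlinarith [mul_nonneg (sub_nonneg.2 hα.le) (sub_nonneg.2 hα'),
          mul_nonneg (mul_nonneg (sub_nonneg.2 hα.le) (sub_nonneg.2 hα')) (sub_nonneg.2 hα.le)]
      have c2 : mu1 α + mu0 α + muNeg1 α = 1 := by unfold mu1 mu0 muNeg1; ring
      nlinarith [mul_nonneg hm c1, mul_nonneg hm hm]
    have := mul_nonneg hg q
    rw [← key] at this
    exact nonneg_of_mul_nonneg_right this (by positivity)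

theorem sum_range_shift (f : ℕ → ℝ) (k M : ℕ) :
    ∑ j ∈ Finset.range M, (if k ≤ j then f (j - k) else 0) = ∑ i ∈ Finset.range (M - k), f i := by
  induction M with
  | zero => simp
  | succ M ih =>
    rw [Finset.sum_range_succ, ih]
    split_ifs with h
    · rw [Nat.succ_sub h, Finset.sum_range_succ]
    · rw [Nat.sub_eq_zero_of_le (by omega : M ≤ k), Nat.sub_eq_zero_of_le (by omega : M + 1 ≤ k)]
      simp

theorem sum_Ico_one_eq_range {M : ℕ} {f : ℕ → ℝ} (h0 : f 0 = 0) :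
    ∑ j ∈ Finset.Ico 1 M, f j = ∑ j ∈ Finset.range M, f j := by
  rcases M with _ | M
  · simp
  · rw [Finset.sum_range_succ', h0, add_zero, Finset.sum_Ico_eq_sum_range]
    simp [add_comm]

theorem sum_shift_sq_le (v : ℕ → ℝ) (M : ℕ) (hM : ∀ j, M ≤ j → v j = 0) :
    ∑ j ∈ Finset.range M, v (j + 1) ^ 2 ≤ ∑ j ∈ Finset.range M, v j ^ 2 := by
  have h1 := Finset.sum_range_succ (fun j => v j ^ 2) M
  have h2 := Finset.sum_range_succ' (fun j => v j ^ 2) M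
  rw [hM M le_rfl] at h1
  nlinarith [sq_nonneg (v 0)]

/-- The Toeplitz form of the weights is negative semidefinite. -/
theorem leftForm_nonpos {α : ℝ} (hα : 1 < α) (hα' : α ≤ 2) (M : ℕ) (v : ℕ → ℝ)
    (hM : ∀ j, M ≤ j → v j = 0) (h0 : v 0 = 0) :
    ∑ j ∈ Finset.Ico 1 M, (∑ k ∈ Finset.range (j + 2), weight α k * v (j + 1 - k)) * v j ≤ 0 := by
  rcases Nat.lt_or_ge M 2 with h2 | h2
  · rw [Finset.Ico_eq_empty (by omega)]; simp
  obtain ⟨m, rfl⟩ := Nat.exists_eq_add_of_le' h2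
  set M := m + 2 with hMdef
  set V := ∑ j ∈ Finset.range M, v j ^ 2 with hV
  have hV0 : 0 ≤ V := Finset.sum_nonneg fun _ _ => sq_nonneg _
  -- `c k` is the autocorrelation of `v` at lag `k - 1`; the guard `k ≤ j + 1` excludes truncated
  -- natural subtraction.
  set c : ℕ → ℝ := fun k =>
    ∑ j ∈ Finset.range M, (if k ≤ j + 1 then v (j + 1 - k) * v j else 0) with hc
  have e1 : ∑ j ∈ Finset.Ico 1 M,
      (∑ k ∈ Finset.range (j + 2), weight α k * v (j + 1 - k)) * v j
      = ∑ k ∈ Finset.range (M + 1), weight α k * c k := by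
    rw [sum_Ico_one_eq_range (by simp [h0])]
    simp only [hc, Finset.mul_sum]
    rw [Finset.sum_comm]
    refine Finset.sum_congr rfl fun j hj => ?_
    rw [Finset.mem_range] at hj
    rw [Finset.sum_mul, ← Finset.sum_subset (s₁ := Finset.range (j + 2))
      (s₂ := Finset.range (M + 1)) (Finset.range_subset_range.2 (by omega))
      (f := fun k => weight α k * if k ≤ j + 1 then v (j + 1 - k) * v j else 0)]
    · refine Finset.sum_congr rfl fun k hk => ?_
      rw [Finset.mem_range] at hk
      rw [if_pos (by omega)]; ring
    · intro k _ hk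
      rw [Finset.mem_range] at hk
      rw [if_neg (by omega), mul_zero]
  have c0 : c 0 = ∑ j ∈ Finset.range M, v (j + 1) * v j := by simp [hc]
  have c1 : c 1 = V := by simp [hc, hV, sq]
  have c2 : c 2 = c 0 := by
    rw [c0]
    have : ∀ j, (if 2 ≤ j + 1 then v (j + 1 - 2) * v j else 0)
        = if 1 ≤ j then (fun i => v i * v (i + 1)) (j - 1) else 0 := by
      intro j
      rcases j with _ | j <;> simp
    simp only [hc]
    rw [Finset.sum_congr rfl fun j _ => this j, sum_range_shift (fun i => v i * v (i + 1))]
    have : M - 1 + 1 = M := by omega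
    conv_rhs => rw [← this, Finset.sum_range_succ, this, hM M le_rfl, zero_mul, add_zero]
    exact Finset.sum_congr rfl fun _ _ => mul_comm _ _
  have c0le : c 0 ≤ V := by
    rw [c0]
    have := sum_shift_sq_le v M hM
    have h3 : ∑ j ∈ Finset.range M, v (j + 1) * v j
        ≤ ∑ j ∈ Finset.range M, (v (j + 1) ^ 2 + v j ^ 2) / 2 :=
      Finset.sum_le_sum fun j _ => by nlinarith [sq_nonneg (v (j + 1) - v j)]
    rw [← Finset.sum_div, Finset.sum_add_distrib] at h3
    linarith
  have ck : ∀ k, c (k + 3) ≤ V := by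
    intro k
    have h3 : c (k + 3) ≤ ∑ j ∈ Finset.range M,
        ((if k + 2 ≤ j then (fun i => v i ^ 2) (j - (k + 2)) else 0) + v j ^ 2) / 2 := by
      refine Finset.sum_le_sum fun j _ => ?_
      by_cases hj : k + 2 ≤ j
      · rw [if_pos (by omega), if_pos hj]
        have : j + 1 - (k + 3) = j - (k + 2) := by omega
        rw [this]
        nlinarith [sq_nonneg (v (j - (k + 2)) - v j)]
      · rw [if_neg (by omega), if_neg hj]
        positivity
    rw [← Finset.sum_div, Finset.sum_add_distrib, sum_range_shift (fun i => v i ^ 2)] at h3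
    have h4 : ∑ i ∈ Finset.range (M - (k + 2)), v i ^ 2 ≤ V :=
      Finset.sum_le_sum_of_subset_of_nonneg (Finset.range_subset_range.2 (by omega))
        fun _ _ _ => sq_nonneg _
    linarith
  rw [e1]
  have hW := sum_weight_nonpos hα hα' m
  -- The term `w_1 c_1 = w_1 V` is exact, so the sign of `w_1` plays no role; `w_0` and `w_2` are
  -- grouped through `c 2 = c 0`, and the remaining weights are nonnegative.
  have : ∑ k ∈ Finset.range (M + 1), weight α k * c k
      ≤ (∑ i ∈ Finset.range (m + 3), weight α i) * V := by
    rw [show M + 1 = m + 3 by omega, Finset.sum_range_succ', Finset.sum_range_succ',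
      Finset.sum_range_succ', Finset.sum_range_succ' (fun i => weight α i),
      Finset.sum_range_succ' (fun i => weight α (i + 1)),
      Finset.sum_range_succ' (fun i => weight α (i + 1 + 1))]
    have h5 : ∑ k ∈ Finset.range m, weight α (k + 1 + 1 + 1) * c (k + 1 + 1 + 1)
        ≤ (∑ k ∈ Finset.range m, weight α (k + 1 + 1 + 1)) * V := by
      rw [Finset.sum_mul]
      exact Finset.sum_le_sum fun k _ =>
        mul_le_mul_of_nonneg_left (ck k) (weight_nonneg hα hα' k)
    have h6 := mul_le_mul_of_nonneg_left c0le (weight_zero_add_two_nonneg hα hα')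
    simp only [zero_add, Nat.reduceAdd, c1, c2] at *
    nlinarith
  exact this.trans (mul_nonpos_of_nonpos_of_nonneg hW hV0)

end CNQuasiCompact
end

/-! ### Discrete operators and energy stability. -/

noncomputable section
namespace CNQuasiCompact

theorem Px_eq {h : ℝ} (hh : h ≠ 0) (α : ℝ) (U : ℕ → ℝ) (j : ℕ) :
    Px α h U j = (1 - 2 * b2 α) * U j + b2 α * (U (j - 1) + U (j + 1)) := by
  unfold Px centeredDiff
  field_simp
  ring

theorem Px_add (α h : ℝ) (U V : ℕ → ℝ) (j : ℕ) :
    Px α h (fun i => U i + V i) j = Px α h U j + Px α h V j := by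
  unfold Px centeredDiff
  ring

theorem Px_sub (α h : ℝ) (U V : ℕ → ℝ) (j : ℕ) :
    Px α h (fun i => U i - V i) j = Px α h U j - Px α h V j := by
  unfold Px centeredDiff
  ring

theorem Px_const_mul (α h c : ℝ) (U : ℕ → ℝ) (j : ℕ) :
    Px α h (fun i => c * U i) j = c * Px α h U j := by
  unfold Px centeredDiff
  ring

theorem leftDiscrete_add (α h : ℝ) (U V : ℕ → ℝ) (j : ℕ) :
    leftDiscrete α h (fun i => U i + V i) j = leftDiscrete α h U j + leftDiscrete α h V j := by
  simp only [leftDiscrete, mul_add, Finset.sum_add_distrib]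

theorem leftDiscrete_sub (α h : ℝ) (U V : ℕ → ℝ) (j : ℕ) :
    leftDiscrete α h (fun i => U i - V i) j = leftDiscrete α h U j - leftDiscrete α h V j := by
  simp only [leftDiscrete, mul_sub, Finset.sum_sub_distrib]

/-- Through the grid reflection `i ↦ M - i` the right operator inherits both negativity and
consistency from the left one. -/
theorem rightDiscrete_eq_leftDiscrete (α h : ℝ) {M j : ℕ} (hj : 1 ≤ j) (hjM : j ≤ M) (U : ℕ → ℝ) :
    rightDiscrete α h M U j = leftDiscrete α h (fun i => U (M - i)) (M - j) := by
  unfold rightDiscrete leftDiscrete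
  congr 1
  refine Finset.sum_congr rfl fun k hk => ?_
  rw [Finset.mem_range] at hk
  congr 2
  omega

theorem rightDiscrete_add (α h : ℝ) (M : ℕ) (U V : ℕ → ℝ) (j : ℕ) :
    rightDiscrete α h M (fun i => U i + V i) j
      = rightDiscrete α h M U j + rightDiscrete α h M V j := by
  simp only [rightDiscrete, mul_add, Finset.sum_add_distrib]

theorem rightDiscrete_sub (α h : ℝ) (M : ℕ) (U V : ℕ → ℝ) (j : ℕ) :
    rightDiscrete α h M (fun i => U i - V i) j
      = rightDiscrete α h M U j - rightDiscrete α h M V j := by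
  simp only [rightDiscrete, mul_sub, Finset.sum_sub_distrib]

theorem leftDiscrete_congr (α h : ℝ) {U V : ℕ → ℝ} {j : ℕ} (hUV : ∀ i ≤ j + 1, U i = V i) :
    leftDiscrete α h U j = leftDiscrete α h V j := by
  unfold leftDiscrete
  congr 1
  exact Finset.sum_congr rfl fun k _ => by rw [hUV _ (by omega)]

theorem rightDiscrete_congr (α h : ℝ) {U V : ℕ → ℝ} {j M : ℕ} (hj : 1 ≤ j) (hjM : j ≤ M)
    (hUV : ∀ i ≤ M, U i = V i) :
    rightDiscrete α h M U j = rightDiscrete α h M V j := by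
  rw [rightDiscrete_eq_leftDiscrete α h hj hjM, rightDiscrete_eq_leftDiscrete α h hj hjM]
  exact leftDiscrete_congr α h fun i _ => hUV _ (by omega)

theorem Px_congr (α h : ℝ) {U V : ℕ → ℝ} {j : ℕ} (hUV : ∀ i ≤ j + 1, U i = V i) :
    Px α h U j = Px α h V j := by
  unfold Px centeredDiff
  rw [hUV (j - 1) (by omega), hUV (j + 1) le_rfl, hUV j (by omega)]

theorem Px_reflect (α h : ℝ) (U : ℕ → ℝ) {j M : ℕ} (hj : 1 ≤ j) (hjM : j < M) :
    Px α h (fun i => U (M - i)) (M - j) = Px α h U j := by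
  unfold Px centeredDiff
  have e1 : M - (M - j) = j := by omega
  have e2 : M - (M - j - 1) = j + 1 := by omega
  have e3 : M - (M - j + 1) = j - 1 := by omega
  simp only [e1, e2, e3]
  ring

theorem b2_nonneg {α : ℝ} (hα : 1 < α) (hα' : α ≤ 2) : 0 ≤ b2 α := by
  unfold b2; nlinarith

theorem b2_le {α : ℝ} (hα : 1 < α) : b2 α ≤ 1 / 6 := by
  unfold b2; nlinarith

/-- Since `0 ≤ b₂ ≤ 1/6`, `P_x` takes convex combinations of three neighbouring values. -/
theorem abs_Px_le {α h : ℝ} (hα : 1 < α) (hα' : α ≤ 2) (hh : h ≠ 0) {U : ℕ → ℝ} {j : ℕ} {c : ℝ}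
    (hU : ∀ i ≤ j + 1, |U i| ≤ c) : |Px α h U j| ≤ c := by
  rw [Px_eq hh]
  have h1 := abs_le.1 (hU j (by omega))
  have h2 := abs_le.1 (hU (j - 1) (by omega))
  have h3 := abs_le.1 (hU (j + 1) le_rfl)
  have b0 := b2_nonneg hα hα'
  have b1 := b2_le hα
  rw [abs_le]
  constructor <;> nlinarith

theorem leftDiscrete_form_nonpos {α h : ℝ} (hα : 1 < α) (hα' : α ≤ 2) (hh : 0 < h) (M : ℕ)
    (v : ℕ → ℝ) (hM : ∀ j, M ≤ j → v j = 0) (h0 : v 0 = 0) :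
    ∑ j ∈ Finset.Ico 1 M, leftDiscrete α h v j * v j ≤ 0 := by
  have := leftForm_nonpos hα hα' M v hM h0
  have e : ∑ j ∈ Finset.Ico 1 M, leftDiscrete α h v j * v j = 1 / h ^ α *
      ∑ j ∈ Finset.Ico 1 M, (∑ k ∈ Finset.range (j + 2), weight α k * v (j + 1 - k)) * v j := by
    rw [Finset.mul_sum]
    exact Finset.sum_congr rfl fun j _ => by unfold leftDiscrete; ring
  rw [e]
  exact mul_nonpos_of_nonneg_of_nonpos (by positivity) this

theorem sum_Ico_one_reflect (M : ℕ) (f : ℕ → ℝ) :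
    ∑ j ∈ Finset.Ico 1 M, f (M - j) = ∑ j ∈ Finset.Ico 1 M, f j := by
  refine Finset.sum_nbij' (fun j => M - j) (fun j => M - j) ?_ ?_ ?_ ?_ fun _ _ => rfl <;>
    simp only [Finset.mem_Ico] <;> intros <;> omega

theorem rightDiscrete_form_nonpos {α h : ℝ} (hα : 1 < α) (hα' : α ≤ 2) (hh : 0 < h) (M : ℕ)
    (v : ℕ → ℝ) (hM : ∀ j, M ≤ j → v j = 0) (h0 : v 0 = 0) :
    ∑ j ∈ Finset.Ico 1 M, rightDiscrete α h M v j * v j ≤ 0 := by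
  have := leftDiscrete_form_nonpos hα hα' hh M (fun i => v (M - i))
    (fun j hj => by rw [Nat.sub_eq_zero_of_le hj, h0]) (by simp [hM M le_rfl])
  rw [← sum_Ico_one_reflect] at this
  refine le_of_eq_of_le (Finset.sum_congr rfl fun j hj => ?_) this
  rw [Finset.mem_Ico] at hj
  rw [rightDiscrete_eq_leftDiscrete α h hj.1 hj.2.le]
  congr 2
  omega

/-- Summation by parts, in a form visibly symmetric in `v` and `w`. -/
theorem sum_Px_mul {α h : ℝ} (hh : h ≠ 0) (M : ℕ) (v w : ℕ → ℝ)
    (hw : ∀ j, M ≤ j → w j = 0) (hw0 : w 0 = 0) :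
    ∑ j ∈ Finset.Ico 1 M, Px α h v j * w j = (1 - 2 * b2 α) * ∑ j ∈ Finset.range M, v j * w j
      + b2 α * (∑ j ∈ Finset.range M, v j * w (j + 1) + ∑ j ∈ Finset.range M, v (j + 1) * w j) := by
  have e : ∑ j ∈ Finset.range M, v (j - 1) * w j = ∑ j ∈ Finset.range M, v j * w (j + 1) := by
    rcases M with _ | M
    · simp
    · rw [Finset.sum_range_succ', Finset.sum_range_succ, hw0, hw (M + 1) le_rfl]
      simp
  rw [sum_Ico_one_eq_range (by simp [hw0]), ← e]
  simp only [Px_eq hh, Finset.mul_sum, ← Finset.sum_add_distrib]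
  exact Finset.sum_congr rfl fun j _ => by ring

/-- The energy of the quasi-compact operator. -/
def energy (α h : ℝ) (M : ℕ) (v : ℕ → ℝ) : ℝ := ∑ j ∈ Finset.Ico 1 M, Px α h v j * v j

/-- The off-diagonal part is at least `-2 b₂ ∑ v_j²`, so the energy is at least `(1 - 4 b₂) ∑ v_j²`,
and `1 - 4 b₂ ≥ 1/3`. -/
theorem sum_sq_le_energy {α h : ℝ} (hα : 1 < α) (hα' : α ≤ 2) (hh : h ≠ 0) (M : ℕ) (v : ℕ → ℝ)
    (hM : ∀ j, M ≤ j → v j = 0) (h0 : v 0 = 0) :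
    ∑ j ∈ Finset.Ico 1 M, v j ^ 2 ≤ 3 * energy α h M v := by
  rw [energy, sum_Px_mul hh M v v hM h0, sum_Ico_one_eq_range (by simp [h0])]
  have h1 := sum_shift_sq_le v M hM
  have h2 : -∑ j ∈ Finset.range M, v j * v (j + 1)
        ≤ ∑ j ∈ Finset.range M, (v (j + 1) ^ 2 + v j ^ 2) / 2 := by
    rw [← Finset.sum_neg_distrib]
    exact Finset.sum_le_sum fun j _ => by nlinarith [sq_nonneg (v (j + 1) + v j)]
  rw [← Finset.sum_div, Finset.sum_add_distrib] at h2
  have h3 : ∑ j ∈ Finset.range M, v (j + 1) * v j = ∑ j ∈ Finset.range M, v j * v (j + 1) :=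
    Finset.sum_congr rfl fun j _ => mul_comm _ _
  have h4 : ∑ j ∈ Finset.range M, v j * v j = ∑ j ∈ Finset.range M, v j ^ 2 :=
    Finset.sum_congr rfl fun j _ => (sq _).symm
  rw [h3, h4]
  have b0 := b2_nonneg hα hα'
  have b1 := b2_le hα
  have h5 : 0 ≤ ∑ j ∈ Finset.range M, v j ^ 2 := Finset.sum_nonneg fun _ _ => sq_nonneg _
  nlinarith

/-- The cross terms of `⟨P(v - w), v + w⟩` cancel because `P_x` is symmetric. -/
theorem energy_sub_energy {α h : ℝ} (hh : h ≠ 0) (M : ℕ) (v w : ℕ → ℝ)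
    (hv : ∀ j, M ≤ j → v j = 0) (hv0 : v 0 = 0) (hw : ∀ j, M ≤ j → w j = 0) (hw0 : w 0 = 0) :
    energy α h M v - energy α h M w
      = ∑ j ∈ Finset.Ico 1 M, (Px α h v j - Px α h w j) * (v j + w j) := by
  have h1 := sum_Px_mul (α := α) hh M v w hw hw0
  have h2 := sum_Px_mul (α := α) hh M w v hv hv0
  have h3 : ∑ j ∈ Finset.Ico 1 M, Px α h v j * w j = ∑ j ∈ Finset.Ico 1 M, Px α h w j * v j := by
    rw [h1, h2]
    simp only [mul_comm (w _)]
    ring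
  have : ∑ j ∈ Finset.Ico 1 M, (Px α h v j - Px α h w j) * (v j + w j)
      = energy α h M v - energy α h M w + (∑ j ∈ Finset.Ico 1 M, Px α h v j * w j
        - ∑ j ∈ Finset.Ico 1 M, Px α h w j * v j) := by
    simp only [energy, ← Finset.sum_sub_distrib, ← Finset.sum_add_distrib]
    exact Finset.sum_congr rfl fun j _ => by ring
  rw [this, h3]
  ring

/-- Testing the step with `v + w` turns the fractional terms into nonpositive forms in `v + w`, and
only the pairing with the residual survives. -/
theorem sqrt_energy_step {α h τ K₁ K₂ ρ : ℝ} (hα : 1 < α) (hα' : α ≤ 2) (hh : 0 < h) (hτ : 0 ≤ τ)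
    (hK₁ : 0 ≤ K₁) (hK₂ : 0 ≤ K₂) (hρ : 0 ≤ ρ) (M : ℕ) (v w r : ℕ → ℝ)
    (hv : ∀ j, M ≤ j → v j = 0) (hv0 : v 0 = 0) (hw : ∀ j, M ≤ j → w j = 0) (hw0 : w 0 = 0)
    (heq : ∀ j, 1 ≤ j → j < M →
      Px α h v j - K₁ * τ / 2 * leftDiscrete α h v j - K₂ * τ / 2 * rightDiscrete α h M v j
      = Px α h w j + K₁ * τ / 2 * leftDiscrete α h w j + K₂ * τ / 2 * rightDiscrete α h M w j + r j)
    (hr : ∀ j, 1 ≤ j → j < M → |r j| ≤ ρ) :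
    √(energy α h M v) ≤ √(energy α h M w) + √3 * (√M * ρ) := by
  set s : ℕ → ℝ := fun j => v j + w j with hs
  have key : energy α h M v - energy α h M w ≤ ∑ j ∈ Finset.Ico 1 M, r j * s j := by
    have hL := leftDiscrete_form_nonpos hα hα' hh M s
      (fun j hj => by simp [hs, hv j hj, hw j hj]) (by simp [hs, hv0, hw0])
    have hR := rightDiscrete_form_nonpos hα hα' hh M s
      (fun j hj => by simp [hs, hv j hj, hw j hj]) (by simp [hs, hv0, hw0])
    rw [energy_sub_energy hh.ne' M v w hv hv0 hw hw0]
    have : ∑ j ∈ Finset.Ico 1 M, (Px α h v j - Px α h w j) * (v j + w j)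
        = K₁ * τ / 2 * ∑ j ∈ Finset.Ico 1 M, leftDiscrete α h s j * s j
        + K₂ * τ / 2 * ∑ j ∈ Finset.Ico 1 M, rightDiscrete α h M s j * s j
        + ∑ j ∈ Finset.Ico 1 M, r j * s j := by
      simp only [Finset.mul_sum, ← Finset.sum_add_distrib]
      refine Finset.sum_congr rfl fun j hj => ?_
      rw [Finset.mem_Ico] at hj
      have := heq j hj.1 hj.2
      rw [leftDiscrete_add, rightDiscrete_add]
      linear_combination s j * this
    rw [this]
    have := mul_nonpos_of_nonneg_of_nonpos (by positivity : 0 ≤ K₁ * τ / 2) hL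
    have := mul_nonpos_of_nonneg_of_nonpos (by positivity : 0 ≤ K₂ * τ / 2) hR
    linarith
  -- Cauchy–Schwarz: `√M` comes from `∑ r_j² ≤ M ρ²`, and `√3` from `sum_sq_le_energy`.
  have hrs : ∀ z : ℕ → ℝ, (∀ j, M ≤ j → z j = 0) → z 0 = 0 →
      ∑ j ∈ Finset.Ico 1 M, r j * z j ≤ √3 * (√M * ρ) * √(energy α h M z) := by
    intro z hz hz0
    have h1 := Real.sum_mul_le_sqrt_mul_sqrt (Finset.Ico 1 M) r z
    have h2 : √(∑ j ∈ Finset.Ico 1 M, z j ^ 2) ≤ √3 * √(energy α h M z) := by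
      rw [← Real.sqrt_mul (by norm_num)]
      exact Real.sqrt_le_sqrt (sum_sq_le_energy hα hα' hh.ne' M z hz hz0)
    have h3 : √(∑ j ∈ Finset.Ico 1 M, r j ^ 2) ≤ √M * ρ := by
      rw [Real.sqrt_le_left (by positivity), mul_pow, Real.sq_sqrt (by positivity)]
      calc ∑ j ∈ Finset.Ico 1 M, r j ^ 2 ≤ ∑ j ∈ Finset.Ico 1 M, ρ ^ 2 := by
            refine Finset.sum_le_sum fun j hj => ?_
            rw [Finset.mem_Ico] at hj
            exact sq_le_sq' (by linarith [abs_le.1 (hr j hj.1 hj.2)])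
              (abs_le.1 (hr j hj.1 hj.2)).2
        _ ≤ M * ρ ^ 2 := by
            rw [Finset.sum_const, Nat.card_Ico, nsmul_eq_mul]
            gcongr
            omega
    calc _ ≤ _ := h1
      _ ≤ (√M * ρ) * (√3 * √(energy α h M z)) := by gcongr
      _ = _ := by ring
  have k1 := hrs v hv hv0
  have k2 := hrs w hw hw0
  have k3 : ∑ j ∈ Finset.Ico 1 M, r j * s j
      = ∑ j ∈ Finset.Ico 1 M, r j * v j + ∑ j ∈ Finset.Ico 1 M, r j * w j := by
    simp only [hs, mul_add, Finset.sum_add_distrib]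
  have nn : ∀ z : ℕ → ℝ, (∀ j, M ≤ j → z j = 0) → z 0 = 0 → 0 ≤ energy α h M z := by
    intro z hz hz0
    have := sum_sq_le_energy hα hα' hh.ne' M z hz hz0
    have h5 : 0 ≤ ∑ j ∈ Finset.Ico 1 M, z j ^ 2 := Finset.sum_nonneg fun _ _ => sq_nonneg _
    linarith
  have q1 := Real.sq_sqrt (nn v hv hv0)
  have q2 := Real.sq_sqrt (nn w hw hw0)
  have p1 := Real.sqrt_nonneg (energy α h M v)
  have p2 := Real.sqrt_nonneg (energy α h M w)
  set A := √(energy α h M v)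
  set B := √(energy α h M w)
  set c := √3 * (√M * ρ) with hc
  have hc0 : 0 ≤ c := by positivity
  -- If `A > B + c` then `A + B > 0`, which contradicts `(A - B)(A + B) ≤ c (A + B)`.
  by_contra! hlt
  have : A ^ 2 - B ^ 2 ≤ c * (A + B) := by linarith
  nlinarith

/-- Stability of the Crank–Nicolson quasi-compact scheme with homogeneous boundary values. -/
theorem sqrt_sum_sq_le_of_scheme {α h τ K₁ K₂ ρ : ℝ} (hα : 1 < α) (hα' : α ≤ 2) (hh : 0 < h)
    (hτ : 0 ≤ τ) (hK₁ : 0 ≤ K₁) (hK₂ : 0 ≤ K₂) (hρ : 0 ≤ ρ) (M N : ℕ) (e r : ℕ → ℕ → ℝ)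
    (he : ∀ n j, M ≤ j → e n j = 0) (he0 : ∀ n ≤ N, e n 0 = 0) (hinit : ∀ j, e 0 j = 0)
    (heq : ∀ n, n < N → ∀ j, 1 ≤ j → j < M →
      Px α h (e (n + 1)) j - K₁ * τ / 2 * leftDiscrete α h (e (n + 1)) j
        - K₂ * τ / 2 * rightDiscrete α h M (e (n + 1)) j
      = Px α h (e n) j + K₁ * τ / 2 * leftDiscrete α h (e n) j
        + K₂ * τ / 2 * rightDiscrete α h M (e n) j + r n j)
    (hr : ∀ n, n < N → ∀ j, 1 ≤ j → j < M → |r n j| ≤ ρ) (n : ℕ) (hn : n ≤ N) :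
    √(∑ j ∈ Finset.Ico 1 M, e n j ^ 2) ≤ 3 * n * (√M * ρ) := by
  have main : ∀ n ≤ N, √(energy α h M (e n)) ≤ n * (√3 * (√M * ρ)) := by
    intro n
    induction n with
    | zero =>
      intro _
      simp [energy, hinit]
    | succ n ih =>
      intro hn
      have := sqrt_energy_step hα hα' hh hτ hK₁ hK₂ hρ M (e (n + 1)) (e n) (r n) (he _)
        (he0 _ hn) (he _) (he0 _ (by omega)) (heq n (by omega)) (hr n (by omega))
      have := ih (by omega)
      push_cast
      linarith
  calc √(∑ j ∈ Finset.Ico 1 M, e n j ^ 2) ≤ √(3 * energy α h M (e n)) :=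
        Real.sqrt_le_sqrt (sum_sq_le_energy hα hα' hh.ne' M _ (he n) (he0 n hn))
    _ = √3 * √(energy α h M (e n)) := Real.sqrt_mul (by norm_num) _
    _ ≤ √3 * (n * (√3 * (√M * ρ))) := by gcongr; exact main n hn
    _ = (√3 * √3) * n * (√M * ρ) := by ring
    _ = 3 * n * (√M * ρ) := by rw [Real.mul_self_sqrt (by norm_num)]

end CNQuasiCompact
end

/-! ### The symbol of the truncation error vanishes to order `α + 4`. -/

noncomputable section
namespace CNQuasiCompact

open Filter Topology Asymptotics Complex

theorem grunwald_three (α : ℝ) : grunwald α 3 = -(α * (α - 1) * (α - 2) / 6) := by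
  have := grunwald_succ α 2
  rw [grunwald_two] at this
  norm_num at this
  linarith

theorem choose_eq_grunwald (α : ℝ) (k : ℕ) :
    Ring.choose (α : ℂ) k = (-1) ^ k * (grunwald α k : ℂ) := by
  rw [← Complex.ofReal_choose, grunwald]
  push_cast
  rw [← mul_assoc, ← mul_pow]
  simp

/-- `fg - pq = f(g - q) + (f - p)q`; this is the rule for multiplying truncated expansions. -/
theorem isBigO_mul_sub_mul {l : Filter ℂ} {f g p q e : ℂ → ℂ} (hf : (fun z => f z - p z) =O[l] e)
    (hg : (fun z => g z - q z) =O[l] e) (hf1 : f =O[l] (1 : ℂ → ℂ)) (hq : q =O[l] (1 : ℂ → ℂ)) :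
    (fun z => f z * g z - p z * q z) =O[l] e := by
  have h1 := hf1.mul hg
  have h2 := hf.mul hq
  have h3 : (fun z => f z * g z - p z * q z)
      = fun z => f z * (g z - q z) + (f z - p z) * q z := by funext z; ring
  rw [h3]
  refine IsBigO.add ?_ ?_
  · simpa using h1
  · simpa using h2

theorem isBigO_one_of_continuous {f : ℂ → ℂ} (hf : Continuous f) :
    f =O[𝓝[≠] 0] (1 : ℂ → ℂ) :=
  ((hf.tendsto 0).mono_left nhdsWithin_le_nhds).isBigO_one ℂ

theorem isBigO_pow_mul {R : ℂ → ℂ} (hR : Continuous R) (n : ℕ) :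
    (fun z => z ^ n * R z) =O[𝓝[≠] 0] fun z => z ^ n := by
  simpa using (isBigO_refl (fun z : ℂ => z ^ n) (𝓝[≠] 0)).mul (isBigO_one_of_continuous hR)

theorem one_add_cpow_isBigO (α : ℝ) :
    (fun y : ℂ => (1 + y) ^ (α : ℂ) - (1 + α * y + grunwald α 2 * y ^ 2 - grunwald α 3 * y ^ 3))
      =O[𝓝 0] fun y => y ^ 4 := by
  have h := (Complex.one_add_cpow_hasFPowerSeriesAt_zero (a := (α : ℂ))).isBigO_sub_partialSum_pow 4
  refine (h.congr_left fun y => ?_).trans (IsBigO.of_norm_right (by simpa using isBigO_refl _ _))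
  simp only [zero_add, FormalMultilinearSeries.partialSum, Finset.sum_range_succ,
    Finset.range_zero, Finset.sum_empty, binomialSeries_apply, choose_eq_grunwald,
    List.ofFn_const, List.prod_replicate, smul_eq_mul, grunwald_zero, grunwald_one]
  push_cast
  ring

/-- The difference quotient `(1 - e^{-z}) / z`. -/
def expQuot (z : ℂ) : ℂ := (1 - exp (-z)) / z

theorem exp_neg_isBigO (n : ℕ) :
    (fun z : ℂ => exp (-z) - ∑ i ∈ Finset.range n, (-z) ^ i / i.factorial)
      =O[𝓝[≠] 0] fun z => z ^ n := by
  have h := (Complex.exp_sub_sum_range_isBigO_pow n).comp_tendsto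
    (continuous_neg.tendsto' (0 : ℂ) 0 neg_zero)
  refine (h.mono nhdsWithin_le_nhds).trans (IsBigO.of_norm_left ?_)
  simp only [Function.comp_apply, norm_pow, norm_neg]
  simpa using (isBigO_refl (fun z : ℂ => z ^ n) (𝓝[≠] 0)).norm_left

theorem expQuot_isBigO :
    (fun z => expQuot z - 1 - (-z / 2 + z ^ 2 / 6 - z ^ 3 / 24)) =O[𝓝[≠] 0] fun z => z ^ 4 := by
  have h := (exp_neg_isBigO 5).mul (isBigO_refl (fun z : ℂ => z⁻¹) (𝓝[≠] 0))
  refine (h.neg_left.congr' ?_ ?_)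
  · filter_upwards [self_mem_nhdsWithin] with z hz
    have hz : z ≠ 0 := hz
    simp only [expQuot, Finset.sum_range_succ, Finset.range_zero, Finset.sum_empty, Nat.factorial]
    field_simp
    push_cast
    ring
  · filter_upwards [self_mem_nhdsWithin] with z hz
    have hz : z ≠ 0 := hz
    field_simp

theorem tendsto_expQuot : Tendsto expQuot (𝓝[≠] 0) (𝓝 1) := by
  have h4 : Tendsto (fun z : ℂ => z ^ 4) (𝓝[≠] 0) (𝓝 0) :=
    ((continuous_pow 4).tendsto' 0 0 (by simp)).mono_left nhdsWithin_le_nhds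
  have h1 := expQuot_isBigO.trans_tendsto h4
  have h2 : Tendsto (fun z : ℂ => 1 + (-z / 2 + z ^ 2 / 6 - z ^ 3 / 24)) (𝓝[≠] 0) (𝓝 1) :=
    (Continuous.tendsto' (by fun_prop) 0 1 (by simp)).mono_left nhdsWithin_le_nhds
  have := h1.add h2
  rw [zero_add] at this
  refine this.congr fun z => ?_
  ring

/-- The cubic Taylor polynomial of `((1 - e^{-z}) / z) ^ α`. -/
theorem expQuot_cpow_isBigO (α : ℝ) :
    (fun z => expQuot z ^ (α : ℂ) - (1 + (-(α : ℂ) / 2) * z + (α / 6 + grunwald α 2 / 4) * z ^ 2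
      + (-(α : ℂ) / 24 - grunwald α 2 / 6 + grunwald α 3 / 8) * z ^ 3))
      =O[𝓝[≠] 0] fun z => z ^ 4 := by
  -- Since `y = O(z)`, the binomial series to third order in `y` is enough, and powers of `y` may be
  -- replaced by powers of its cubic polynomial `p`.
  set y : ℂ → ℂ := fun z => expQuot z - 1 with hy
  set p : ℂ → ℂ := fun z => -z / 2 + z ^ 2 / 6 - z ^ 3 / 24 with hp
  have hpc : Continuous p := by rw [hp]; fun_prop
  have hyp : (fun z => y z - p z) =O[𝓝[≠] 0] fun z => z ^ 4 := expQuot_isBigO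
  have hy0 : Tendsto y (𝓝[≠] 0) (𝓝 0) := by
    have := tendsto_expQuot.sub_const 1
    rwa [sub_self] at this
  have hy1 : y =O[𝓝[≠] 0] (1 : ℂ → ℂ) := hy0.isBigO_one ℂ
  have hp1 := isBigO_one_of_continuous hpc
  have hyz : y =O[𝓝[≠] 0] fun z => z := by
    have h1 : p =O[𝓝[≠] 0] fun z => z := by
      have := isBigO_pow_mul (R := fun z => -1 / 2 + z / 6 - z ^ 2 / 24) (by fun_prop) 1
      refine (this.congr (fun z => ?_) fun z => pow_one z)
      simp only [hp]; ring
    have h2 : (fun z : ℂ => z ^ 4) =O[𝓝[≠] 0] fun z => z := by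
      have := isBigO_pow_mul (R := fun z => z ^ 3) (by fun_prop) 1
      refine (this.congr (fun z => ?_) fun z => pow_one z)
      ring
    refine ((hyp.trans h2).add h1).congr_left fun z => ?_
    ring
  have hy4 : (fun z => y z ^ 4) =O[𝓝[≠] 0] fun z => z ^ 4 := hyz.pow 4
  have hpow := ((one_add_cpow_isBigO α).comp_tendsto hy0).trans hy4
  have hyy := isBigO_mul_sub_mul hyp hyp hy1 hp1
  have hyyy := isBigO_mul_sub_mul hyp hyy hy1 (isBigO_one_of_continuous (hpc.mul hpc))
  -- Here and in `hppp` the polynomial `R` is the exact quotient of the discarded terms by `z⁴`.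
  have hpp : (fun z => p z * p z - (z ^ 2 / 4 - z ^ 3 / 6)) =O[𝓝[≠] 0] fun z => z ^ 4 := by
    refine (isBigO_pow_mul (R := fun z => 1 / 24 + 1 / 36 - z / 72 + z ^ 2 / 576)
      (by fun_prop) 4).congr_left fun z => ?_
    simp only [hp]; ring
  have hppp : (fun z => p z * (p z * p z) - (-z ^ 3 / 8)) =O[𝓝[≠] 0] fun z => z ^ 4 := by
    refine (isBigO_pow_mul (R := fun z => 1 / 8 - 7 / 96 * z + 11 / 432 * z ^ 2
      - 7 / 1152 * z ^ 3 + z ^ 4 / 1152 - z ^ 5 / 13824) (by fun_prop) 4).congr_left fun z => ?_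
    simp only [hp]; ring
  have e1 := hyp.const_mul_left (α : ℂ)
  have e2 := (hyy.add hpp).const_mul_left (grunwald α 2 : ℂ)
  have e3 := (hyyy.add hppp).const_mul_left (grunwald α 3 : ℂ)
  refine ((hpow.add (e1.add e2)).sub e3).congr_left fun z => ?_
  simp only [Function.comp_apply, hy, hp]
  rw [show 1 + (expQuot z - 1) = expQuot z by ring]
  ring

/-- The symbol of the truncation error of the quasi-compact operator at step one. -/
def symbol (α : ℝ) (z : ℂ) : ℂ :=
  (1 - exp (-z)) ^ (α : ℂ) * (mu1 α * exp z + mu0 α + muNeg1 α * exp (-z))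
    - z ^ (α : ℂ) * (1 + b2 α * (exp z - 2 + exp (-z)))

theorem exp_isBigO_four :
    (fun z : ℂ => exp z - (1 + z + z ^ 2 / 2 + z ^ 3 / 6)) =O[𝓝[≠] 0] fun z => z ^ 4 := by
  refine ((Complex.exp_sub_sum_range_isBigO_pow 4).mono nhdsWithin_le_nhds).congr_left fun z => ?_
  simp only [Finset.sum_range_succ, Finset.range_zero, Finset.sum_empty, Nat.factorial]
  push_cast
  ring

theorem exp_neg_isBigO_four :
    (fun z : ℂ => exp (-z) - (1 - z + z ^ 2 / 2 - z ^ 3 / 6)) =O[𝓝[≠] 0] fun z => z ^ 4 := by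
  refine (exp_neg_isBigO 4).congr_left fun z => ?_
  simp only [Finset.sum_range_succ, Finset.range_zero, Finset.sum_empty, Nat.factorial]
  push_cast
  ring

/-- The values of the `μ` and of `b₂` enter here: they make the expansion of the product agree with
`1 + b₂ z²` through the cubic term. -/
theorem reduced_symbol_isBigO (α : ℝ) :
    (fun z => expQuot z ^ (α : ℂ) * (mu1 α * exp z + mu0 α + muNeg1 α * exp (-z))
      - (1 + b2 α * (exp z - 2 + exp (-z)))) =O[𝓝[≠] 0] fun z => z ^ 4 := by
  have hE : (fun z : ℂ => (mu1 α * exp z + mu0 α + muNeg1 α * exp (-z))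
      - ((mu1 α + mu0 α + muNeg1 α) + (mu1 α - muNeg1 α) * z + (mu1 α + muNeg1 α) / 2 * z ^ 2
        + (mu1 α - muNeg1 α) / 6 * z ^ 3)) =O[𝓝[≠] 0] fun z => z ^ 4 := by
    refine ((exp_isBigO_four.const_mul_left (mu1 α : ℂ)).add
      (exp_neg_isBigO_four.const_mul_left (muNeg1 α : ℂ))).congr_left fun z => ?_
    ring
  have hB : (fun z : ℂ => (1 + b2 α * (exp z - 2 + exp (-z))) - (1 + b2 α * z ^ 2))
      =O[𝓝[≠] 0] fun z => z ^ 4 := by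
    refine ((exp_isBigO_four.add exp_neg_isBigO_four).const_mul_left (b2 α : ℂ)).congr_left
      fun z => ?_
    ring
  have hq1 : (fun z => expQuot z ^ (α : ℂ)) =O[𝓝[≠] 0] (1 : ℂ → ℂ) := by
    have : ContinuousAt (fun w : ℂ => w ^ (α : ℂ)) 1 :=
      continuousAt_cpow_const (by simp [Complex.mem_slitPlane_iff])
    exact (this.tendsto.comp tendsto_expQuot).isBigO_one ℂ
  have hm := isBigO_mul_sub_mul (expQuot_cpow_isBigO α) hE hq1
    (isBigO_one_of_continuous (by fun_prop))
  have hpoly : (fun z : ℂ => (1 + (-(α : ℂ) / 2) * z + (α / 6 + grunwald α 2 / 4) * z ^ 2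
      + (-(α : ℂ) / 24 - grunwald α 2 / 6 + grunwald α 3 / 8) * z ^ 3)
      * ((mu1 α + mu0 α + muNeg1 α) + (mu1 α - muNeg1 α) * z + (mu1 α + muNeg1 α) / 2 * z ^ 2
        + (mu1 α - muNeg1 α) / 6 * z ^ 3) - (1 + b2 α * z ^ 2)) =O[𝓝[≠] 0] fun z => z ^ 4 := by
    refine (isBigO_pow_mul (R := fun z =>
      (-(α : ℂ) / 2) * ((mu1 α - muNeg1 α) / 6)
      + (α / 6 + grunwald α 2 / 4) * ((mu1 α + muNeg1 α) / 2)
      + (-(α : ℂ) / 24 - grunwald α 2 / 6 + grunwald α 3 / 8) * (mu1 α - muNeg1 α)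
      + ((α / 6 + grunwald α 2 / 4) * ((mu1 α - muNeg1 α) / 6)
        + (-(α : ℂ) / 24 - grunwald α 2 / 6 + grunwald α 3 / 8) * ((mu1 α + muNeg1 α) / 2)) * z
      + (-(α : ℂ) / 24 - grunwald α 2 / 6 + grunwald α 3 / 8) * ((mu1 α - muNeg1 α) / 6) * z ^ 2)
      (by fun_prop) 4).congr_left fun z => ?_
    simp only [grunwald_two, grunwald_three, mu1, mu0, muNeg1, b2]
    push_cast
    ring
  refine ((hm.add hpoly).sub hB).congr_left fun z => ?_
  ring

/-- Both factors have argument in `(-π/2, π/2)`, so the principal logarithms add without a jump. -/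
theorem one_sub_exp_neg_cpow {z : ℂ} (hz : 0 < z.re) (hq : 0 < (expQuot z).re) (α : ℝ) :
    (1 - exp (-z)) ^ (α : ℂ) = z ^ (α : ℂ) * expQuot z ^ (α : ℂ) := by
  have hz0 : z ≠ 0 := fun h => by simp [h] at hz
  have hq0 : expQuot z ≠ 0 := fun h => by simp [h] at hq
  have e : 1 - exp (-z) = z * expQuot z := by unfold expQuot; field_simp
  have h1 := abs_lt.1 (Complex.abs_arg_lt_pi_div_two_iff.2 (Or.inl hz))
  have h2 := abs_lt.1 (Complex.abs_arg_lt_pi_div_two_iff.2 (Or.inl hq))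
  rw [e, cpow_def_of_ne_zero (mul_ne_zero hz0 hq0), cpow_def_of_ne_zero hz0,
    cpow_def_of_ne_zero hq0, Complex.log_mul hz0 hq0 ⟨by linarith, by linarith⟩, ← exp_add]
  ring_nf

theorem norm_symbol_le_near (α : ℝ) : ∃ C δ : ℝ, 0 ≤ C ∧ 0 < δ ∧
    ∀ z : ℂ, 0 < z.re → ‖z‖ < δ → ‖symbol α z‖ ≤ C * ‖z‖ ^ (α + 4) := by
  obtain ⟨C, hC⟩ := (reduced_symbol_isBigO α).bound
  have hre : ∀ᶠ z in 𝓝[≠] (0 : ℂ), 0 < (expQuot z).re :=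
    ((Complex.continuous_re.tendsto 1).comp tendsto_expQuot).eventually_const_lt (by simp)
  have hev := hC.and hre
  rw [eventually_nhdsWithin_iff, Metric.eventually_nhds_iff] at hev
  obtain ⟨δ, hδ, hev⟩ := hev
  refine ⟨max C 0, δ, le_max_right _ _, hδ, fun z hz hzδ => ?_⟩
  have hz0 : z ≠ 0 := fun h => by simp [h] at hz
  obtain ⟨h1, h2⟩ := hev (by simpa using hzδ) hz0
  have hn : 0 < ‖z‖ := norm_pos_iff.2 hz0
  have e : symbol α z = z ^ (α : ℂ) *
      (expQuot z ^ (α : ℂ) * (mu1 α * exp z + mu0 α + muNeg1 α * exp (-z))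
      - (1 + b2 α * (exp z - 2 + exp (-z)))) := by
    rw [symbol, one_sub_exp_neg_cpow hz h2]
    ring
  rw [e, norm_mul, norm_cpow_real, Real.rpow_add hn]
  rw [norm_pow] at h1
  have : ‖z‖ ^ (4 : ℝ) = ‖z‖ ^ 4 := by exact_mod_cast Real.rpow_natCast ‖z‖ 4
  rw [this]
  calc _ ≤ ‖z‖ ^ α * (C * ‖z‖ ^ 4) := by gcongr
    _ ≤ ‖z‖ ^ α * (max C 0 * ‖z‖ ^ 4) := by gcongr; exact le_max_left _ _
    _ = _ := by ring

/-- For `|z| ≥ δ` the strip bounds the exponentials, so the symbol is at most `c₁ + c₂ |z|^α`; this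
is absorbed into `|z|^(α+4)` at the cost of powers of `δ`. -/
theorem norm_symbol_le {α : ℝ} (hα : 0 ≤ α) (L : ℝ) : ∃ C : ℝ, 0 ≤ C ∧
    ∀ z : ℂ, 0 < z.re → z.re ≤ L → ‖symbol α z‖ ≤ C * ‖z‖ ^ (α + 4) := by
  obtain ⟨C, δ, hC, hδ, hnear⟩ := norm_symbol_le_near α
  set c₁ : ℝ := 2 ^ α * (|mu1 α| * Real.exp L + |mu0 α| + |muNeg1 α|) with hc₁
  set c₂ : ℝ := 1 + |b2 α| * (Real.exp L + 3) with hc₂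
  have hc₁0 : 0 ≤ c₁ := by positivity
  have hc₂0 : 0 ≤ c₂ := by positivity
  refine ⟨C + (c₁ / δ ^ (α + 4) + c₂ / δ ^ 4), by positivity, fun z hz hzL => ?_⟩
  have hz0 : z ≠ 0 := fun h => by simp [h] at hz
  have hn : 0 < ‖z‖ := norm_pos_iff.2 hz0
  rw [add_mul]
  rcases lt_or_ge ‖z‖ δ with h | h
  · have := hnear z hz h
    have : 0 ≤ (c₁ / δ ^ (α + 4) + c₂ / δ ^ 4) * ‖z‖ ^ (α + 4) := by positivity
    linarith
  · have hez : ‖exp z‖ ≤ Real.exp L := by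
      rw [Complex.norm_exp]; exact Real.exp_le_exp.2 hzL
    have hemz : ‖exp (-z)‖ ≤ 1 := by
      rw [Complex.norm_exp]; exact Real.exp_le_one_iff.2 (by simpa using hz.le)
    have h1 : ‖(1 - exp (-z)) ^ (α : ℂ)‖ ≤ 2 ^ α := by
      rw [norm_cpow_real]
      refine Real.rpow_le_rpow (norm_nonneg _) ?_ hα
      calc _ ≤ ‖(1 : ℂ)‖ + ‖exp (-z)‖ := norm_sub_le _ _
        _ ≤ 2 := by rw [norm_one]; linarith
    have h2 : ‖(mu1 α * exp z + mu0 α + muNeg1 α * exp (-z) : ℂ)‖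
        ≤ |mu1 α| * Real.exp L + |mu0 α| + |muNeg1 α| := by
      refine (norm_add₃_le).trans ?_
      rw [norm_mul, norm_mul, norm_real, norm_real, norm_real]
      simp only [Real.norm_eq_abs]
      have := mul_le_mul_of_nonneg_left hez (abs_nonneg (mu1 α))
      have := mul_le_mul_of_nonneg_left hemz (abs_nonneg (muNeg1 α))
      linarith
    have h3 : ‖(1 + b2 α * (exp z - 2 + exp (-z)) : ℂ)‖ ≤ c₂ := by
      refine (norm_add_le _ _).trans ?_
      rw [norm_one, norm_mul, norm_real, Real.norm_eq_abs, hc₂]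
      gcongr
      refine (norm_add_le _ _).trans ?_
      have := norm_sub_le (exp z) 2
      rw [show ‖(2 : ℂ)‖ = 2 by simp] at this
      linarith
    have h4 : ‖symbol α z‖ ≤ c₁ + ‖z‖ ^ α * c₂ := by
      unfold symbol
      refine (norm_sub_le _ _).trans ?_
      rw [norm_mul, norm_mul, norm_cpow_real z]
      gcongr
      rw [hc₁]
      gcongr
    have h5 : c₁ ≤ c₁ / δ ^ (α + 4) * ‖z‖ ^ (α + 4) := by
      rw [div_mul_eq_mul_div, le_div_iff₀ (by positivity)]
      gcongr
    have h6 : ‖z‖ ^ α * c₂ ≤ c₂ / δ ^ 4 * ‖z‖ ^ (α + 4) := by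
      have : ‖z‖ ^ (4 : ℝ) = ‖z‖ ^ 4 := by exact_mod_cast Real.rpow_natCast ‖z‖ 4
      rw [Real.rpow_add hn, this, div_mul_eq_mul_div, le_div_iff₀ (by positivity)]
      calc _ = c₂ * (‖z‖ ^ α * δ ^ 4) := by ring
        _ ≤ _ := by gcongr
    have : 0 ≤ C * ‖z‖ ^ (α + 4) := by positivity
    linarith

end CNQuasiCompact
end

/-! ### Truncated powers by Laplace inversion, and the generating function of the weights. -/

noncomputable section
namespace CNQuasiCompact

open Filter Topology Complex MeasureTheory FourierTransform

/-- The normalized truncated power `x₊ ^ γ / Γ (γ + 1)`. -/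
def truncPow (γ x : ℝ) : ℝ := (max x 0) ^ γ / Real.Gamma (γ + 1)

theorem truncPow_of_nonpos {γ x : ℝ} (hγ : 0 < γ) (hx : x ≤ 0) : truncPow γ x = 0 := by
  rw [truncPow, max_eq_right hx, Real.zero_rpow hγ.ne', zero_div]

theorem truncPow_of_nonneg {γ x : ℝ} (hx : 0 ≤ x) :
    truncPow γ x = x ^ γ / Real.Gamma (γ + 1) := by
  rw [truncPow, max_eq_left hx]

theorem continuous_truncPow {γ : ℝ} (hγ : 0 < γ) : Continuous (truncPow γ) :=
  ((continuous_id.max continuous_const).rpow_const fun _ => Or.inr hγ.le).div_const _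

/-- Points of the vertical line `Re s = 1`. -/
def lineOne (ξ : ℝ) : ℂ := 1 + 2 * Real.pi * ξ * I

theorem lineOne_re (ξ : ℝ) : (lineOne ξ).re = 1 := by simp [lineOne]

theorem lineOne_im (ξ : ℝ) : (lineOne ξ).im = 2 * Real.pi * ξ := by simp [lineOne]

theorem continuous_lineOne : Continuous lineOne := by unfold lineOne; fun_prop

theorem lineOne_ne_zero (ξ : ℝ) : lineOne ξ ≠ 0 := fun h => by
  have := lineOne_re ξ
  simp [h] at this

theorem sqrt_le_norm_lineOne (ξ : ℝ) : (1 + ‖ξ‖ ^ 2) ^ (1 / 2 : ℝ) ≤ ‖lineOne ξ‖ := by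
  rw [← Real.sqrt_eq_rpow, Complex.norm_def, Complex.normSq_apply, lineOne_re, lineOne_im]
  refine Real.sqrt_le_sqrt ?_
  have h1 := Real.pi_gt_three
  rw [Real.norm_eq_abs, sq_abs]
  have : ξ ^ 2 ≤ (2 * Real.pi) ^ 2 * ξ ^ 2 :=
    le_mul_of_one_le_left (sq_nonneg _) (by nlinarith)
  nlinarith

theorem integrable_norm_lineOne_rpow {r : ℝ} (hr : 1 < r) :
    Integrable fun ξ => ‖lineOne ξ‖ ^ (-r) := by
  have h := integrable_rpow_neg_one_add_norm_sq (E := ℝ) (μ := volume) (r := r) (by simpa using hr)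
  refine h.mono' ?_ (Eventually.of_forall fun ξ => ?_)
  · exact (continuous_lineOne.norm.rpow_const fun ξ =>
      Or.inl (norm_ne_zero_iff.2 (lineOne_ne_zero ξ))).aestronglyMeasurable
  · rw [Real.norm_of_nonneg (by positivity)]
    have h1 : (0 : ℝ) < (1 + ‖ξ‖ ^ 2) ^ (1 / 2 : ℝ) := by positivity
    have := Real.rpow_le_rpow_of_nonpos h1 (sqrt_le_norm_lineOne ξ) (by linarith : -r ≤ 0)
    refine this.trans_eq ?_
    rw [← Real.rpow_mul (by positivity)]
    congr 1
    ring

theorem lineOne_cpow_continuous (c : ℂ) : Continuous fun ξ => lineOne ξ ^ c := by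
  refine continuous_lineOne.cpow continuous_const fun ξ => ?_
  simp [Complex.mem_slitPlane_iff, lineOne_re]

theorem integrable_lineOne_cpow {r : ℝ} (hr : 1 < r) :
    Integrable fun ξ => lineOne ξ ^ (-(r : ℂ)) := by
  rw [← integrable_norm_iff (lineOne_cpow_continuous _).aestronglyMeasurable]
  refine (integrable_norm_lineOne_rpow hr).congr (Eventually.of_forall fun ξ => ?_)
  simp only
  rw [← ofReal_neg, norm_cpow_real]

theorem integrable_exp_neg_mul_truncPow {γ : ℝ} (hγ : 0 < γ) :
    Integrable fun y => ((Real.exp (-y) * truncPow γ y : ℝ) : ℂ) := by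
  refine Integrable.ofReal ?_
  rw [← integrableOn_univ, ← Iic_union_Ioi (a := (0 : ℝ)), integrableOn_union]
  constructor
  · refine integrableOn_zero.congr_fun (fun y hy => ?_) measurableSet_Iic
    change 0 = Real.exp (-y) * truncPow γ y
    rw [truncPow_of_nonpos hγ hy, mul_zero]
  · have := (Real.GammaIntegral_convergent (s := γ + 1) (by linarith)).div_const
      (Real.Gamma (γ + 1))
    refine IntegrableOn.congr_fun this (fun y hy => ?_) measurableSet_Ioi
    change _ = Real.exp (-y) * truncPow γ y
    rw [truncPow_of_nonneg (mem_Ioi.1 hy).le, add_sub_cancel_right, mul_div_assoc]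

/-- The Gamma integral with a complex rate. -/
theorem integral_rpow_mul_exp_neg_mul_Ioi {γ : ℝ} (hγ : -1 < γ) {s : ℂ} (hs : 0 < s.re) :
    ∫ t : ℝ in Ioi 0, ((t ^ γ : ℝ) : ℂ) * exp (-(s * t))
      = s ^ (-((γ + 1 : ℝ) : ℂ)) * Real.Gamma (γ + 1) := by
  -- For the measure `t^γ dt` on `(0, ∞)` the left side is a complex moment generating function,
  -- hence analytic for `Re s > 0`. The formula for real rates then extends by the identity theorem.
  set d : ℝ → ENNReal := fun t => ENNReal.ofReal (t ^ γ) with hd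
  have hdm : Measurable d := by fun_prop
  have hdfin : ∀ᵐ t ∂(volume.restrict (Ioi (0 : ℝ))), d t < ⊤ :=
    Eventually.of_forall fun _ => ENNReal.ofReal_lt_top
  set μ : Measure ℝ := (volume.restrict (Ioi (0 : ℝ))).withDensity d with hμ
  have hmgf : ∀ z : ℂ, ProbabilityTheory.complexMGF id μ (-z)
      = ∫ t : ℝ in Ioi 0, ((t ^ γ : ℝ) : ℂ) * exp (-(z * t)) := fun z => by
    rw [ProbabilityTheory.complexMGF, hμ,
      integral_withDensity_eq_integral_toReal_smul hdm hdfin]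
    refine setIntegral_congr_fun measurableSet_Ioi fun t ht => ?_
    have : 0 ≤ t ^ γ := Real.rpow_nonneg (mem_Ioi.1 ht).le _
    simp [hd, ENNReal.toReal_ofReal this]
  have hsub : Iio (0 : ℝ) ⊆ interior (ProbabilityTheory.integrableExpSet id μ) := by
    refine interior_maximal (fun t ht => ?_) isOpen_Iio
    have h := integrableOn_rpow_mul_exp_neg_mul_rpow hγ one_pos (neg_pos.2 (mem_Iio.1 ht))
    change Integrable _ μ
    rw [hμ, integrable_withDensity_iff_integrable_smul' hdm hdfin]
    refine IntegrableOn.congr_fun h (fun x hx => ?_) measurableSet_Ioi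
    have : 0 ≤ x ^ γ := Real.rpow_nonneg (mem_Ioi.1 hx).le _
    simp [hd, ENNReal.toReal_ofReal this]
  have hpre : IsPreconnected {z : ℂ | 0 < z.re} :=
    (convex_halfSpace_re_gt 0).isPreconnected
  have hopen : IsOpen {z : ℂ | 0 < z.re} := isOpen_lt continuous_const Complex.continuous_re
  have hf : AnalyticOnNhd ℂ (fun z => ProbabilityTheory.complexMGF id μ (-z)) {z | 0 < z.re} := by
    refine DifferentiableOn.analyticOnNhd (fun z hz => ?_) hopen
    have hz : -z ∈ {z : ℂ | z.re ∈ interior (ProbabilityTheory.integrableExpSet id μ)} :=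
      hsub (by simpa using hz)
    have := (ProbabilityTheory.hasDerivAt_complexMGF hz).differentiableAt
    exact (this.comp z differentiableAt_id.neg).differentiableWithinAt
  have hg : AnalyticOnNhd ℂ (fun z : ℂ => z ^ (-((γ + 1 : ℝ) : ℂ)) * Real.Gamma (γ + 1))
      {z | 0 < z.re} := by
    refine DifferentiableOn.analyticOnNhd (fun z hz => ?_) hopen
    have hz : z ∈ slitPlane := Or.inl hz
    exact ((differentiableAt_id.cpow_const hz).mul_const _).differentiableWithinAt
  have hreal : ∀ r : ℝ, 0 < r → ProbabilityTheory.complexMGF id μ (-(r : ℂ))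
      = (r : ℂ) ^ (-((γ + 1 : ℝ) : ℂ)) * Real.Gamma (γ + 1) := fun r hr => by
    have h := integral_cpow_mul_exp_neg_mul_Ioi (a := ((γ + 1 : ℝ) : ℂ)) (r := r)
      (by rw [ofReal_re]; linarith) hr
    rw [hmgf, cpow_neg, ← inv_cpow_ofReal_nonneg hr.le, ← one_div, ← Complex.Gamma_ofReal, ← h]
    refine setIntegral_congr_fun measurableSet_Ioi fun t ht => ?_
    have e1 : ((γ + 1 : ℝ) : ℂ) - 1 = (γ : ℝ) := by push_cast; ring
    rw [e1, ofReal_cpow (mem_Ioi.1 ht).le]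
  rw [← hmgf]
  refine hf.eqOn_of_preconnected_of_frequently_eq hg hpre (z₀ := 1) (by simp) ?_ hs
  -- Real points different from `1` and accumulating there.
  have ht : Tendsto (fun n : ℕ => (((1 : ℝ) + 1 / ((n : ℝ) + 1) : ℝ) : ℂ)) atTop (𝓝[≠] 1) := by
    refine tendsto_nhdsWithin_iff.2 ⟨?_, Eventually.of_forall fun n => ?_⟩
    · have := (tendsto_one_div_add_atTop_nhds_zero_nat (𝕜 := ℝ)).const_add 1
      rw [add_zero] at this
      exact (Complex.continuous_ofReal.tendsto' 1 1 ofReal_one).comp this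
    · have : (0 : ℝ) < 1 / ((n : ℝ) + 1) := by positivity
      rw [mem_compl_singleton_iff, ← ofReal_one, Ne, ofReal_inj]
      linarith
  exact ht.frequently (Frequently.of_forall fun n => hreal _ (by positivity))

/-- The damping `e^(-y)` turns the Fourier integral into the Laplace integral at `s = 1 + 2πiξ`; as
`2π` sits in `lineOne`, the inversion formula carries no constant. -/
theorem fourier_exp_neg_mul_truncPow {γ : ℝ} (hγ : 0 < γ) (ξ : ℝ) :
    𝓕 (fun y : ℝ => ((Real.exp (-y) * truncPow γ y : ℝ) : ℂ)) ξ
      = lineOne ξ ^ (-((γ + 1 : ℝ) : ℂ)) := by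
  have hG : (Real.Gamma (γ + 1) : ℂ) ≠ 0 := by
    exact_mod_cast (Real.Gamma_pos_of_pos (by linarith)).ne'
  have hint := integral_rpow_mul_exp_neg_mul_Ioi (γ := γ) (by linarith) (s := lineOne ξ)
    (by rw [lineOne_re]; norm_num)
  rw [Real.fourier_eq', ← setIntegral_univ, ← Iic_union_Ioi (a := (0 : ℝ)),
    setIntegral_union (by simp) measurableSet_Ioi]
  rotate_left
  · refine integrableOn_zero.congr_fun (fun y hy => ?_) measurableSet_Iic
    simp [truncPow_of_nonpos hγ hy]
  · refine Integrable.integrableOn ?_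
    refine (integrable_exp_neg_mul_truncPow hγ).bdd_mul (c := 1) ?_ ?_
    · exact Continuous.aestronglyMeasurable (by fun_prop)
    · refine Eventually.of_forall fun y => ?_
      rw [Complex.norm_exp_ofReal_mul_I]
  rw [setIntegral_eq_zero_of_forall_eq_zero, zero_add]
  rotate_left
  · intro y hy
    simp [truncPow_of_nonpos hγ hy]
  rw [eq_div_of_mul_eq hG hint.symm, ← integral_div]
  refine setIntegral_congr_fun measurableSet_Ioi fun y hy => ?_
  have hy : 0 < y := hy
  simp only [smul_eq_mul]
  rw [truncPow_of_nonneg hy.le]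
  push_cast
  have e : exp (-(lineOne ξ * y)) = exp (-2 * Real.pi * (inner ℝ y ξ : ℝ) * I) * exp (-y) := by
    rw [← Complex.exp_add]
    congr 1
    simp [lineOne]
    ring
  rw [e]
  ring

/-- Inverse Laplace transform of `s ^ (-(γ + 1))` along the line `Re s = 1`. -/
theorem truncPow_eq_integral {γ : ℝ} (hγ : 0 < γ) (y : ℝ) :
    (truncPow γ y : ℂ) = ∫ ξ, Complex.exp (lineOne ξ * y) * lineOne ξ ^ (-((γ + 1 : ℝ) : ℂ)) := by
  have hF : 𝓕 (fun y : ℝ => ((Real.exp (-y) * truncPow γ y : ℝ) : ℂ))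
      = fun ξ => lineOne ξ ^ (-((γ + 1 : ℝ) : ℂ)) := funext (fourier_exp_neg_mul_truncPow hγ)
  have hcont : Continuous fun y : ℝ => ((Real.exp (-y) * truncPow γ y : ℝ) : ℂ) := by
    have := continuous_truncPow hγ
    fun_prop
  have hinv := Continuous.fourierInv_fourier_eq hcont (integrable_exp_neg_mul_truncPow hγ)
    (by rw [hF]; exact integrable_lineOne_cpow (by linarith))
  have := congrFun hinv y
  rw [hF, Real.fourierInv_eq'] at this
  have e : (truncPow γ y : ℂ)
      = Complex.exp y * ((Real.exp (-y) * truncPow γ y : ℝ) : ℂ) := by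
    push_cast
    rw [← mul_assoc, ← Complex.exp_add]
    simp
  rw [e, ← this, ← integral_const_mul]
  refine integral_congr_ae (Eventually.of_forall fun ξ => ?_)
  simp only [smul_eq_mul]
  rw [← mul_assoc, ← Complex.exp_add]
  congr 2
  simp [lineOne]
  ring

/-- From index `1` on, `|k - α| ≤ k + 1` prevents growth. Boundedness is all that the exchange of
sum and integral needs. -/
theorem abs_grunwald_le {α : ℝ} (hα : 1 < α) (hα' : α ≤ 2) (k : ℕ) : |grunwald α k| ≤ 2 := by
  induction k with
  | zero => simp [grunwald_zero]
  | succ k ih =>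
    rcases k with _ | k
    · rw [zero_add, grunwald_one, abs_neg, abs_of_pos (by linarith)]
      exact hα'
    · have h := grunwald_succ α (k + 1)
      have hk : (0 : ℝ) ≤ k := Nat.cast_nonneg k
      have h1 : ((k : ℝ) + 2) * |grunwald α (k + 1 + 1)| ≤ (k + 2) * 2 := by
        rw [← abs_of_nonneg (by positivity : (0 : ℝ) ≤ k + 2), ← abs_mul]
        push_cast at h
        rw [show ((k : ℝ) + 2) = k + 1 + 1 by ring, h, abs_mul]
        refine mul_le_mul ?_ ih (abs_nonneg _) (abs_nonneg _)
        rw [abs_of_nonneg (by positivity : (0 : ℝ) ≤ k + 1 + 1), abs_le]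
        constructor <;> linarith
      exact le_of_mul_le_mul_left h1 (by positivity)

theorem abs_weight_le {α : ℝ} (hα : 1 < α) (hα' : α ≤ 2) (k : ℕ) :
    |weight α k| ≤ 2 * (|mu1 α| + |mu0 α| + |muNeg1 α|) := by
  have hg := abs_grunwald_le hα hα'
  have m1 : ∀ c : ℝ, ∀ i, |c * grunwald α i| ≤ 2 * |c| := fun c i => by
    rw [abs_mul]
    have := mul_le_mul_of_nonneg_left (hg i) (abs_nonneg c)
    linarith
  have := abs_nonneg (mu1 α)
  have := abs_nonneg (mu0 α)
  have := abs_nonneg (muNeg1 α)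
  rcases k with _ | _ | k
  · have := m1 (mu1 α) 0
    simp only [weight]
    linarith
  · have := m1 (mu1 α) 1
    have := m1 (mu0 α) 0
    have := abs_add_le (mu0 α * grunwald α 0) (mu1 α * grunwald α 1)
    simp only [weight]
    linarith
  · have := m1 (mu1 α) (k + 2)
    have := m1 (mu0 α) (k + 1)
    have := m1 (muNeg1 α) k
    have := abs_add_three (mu1 α * grunwald α (k + 2)) (mu0 α * grunwald α (k + 1))
      (muNeg1 α * grunwald α k)
    simp only [weight]
    linarith

theorem hasSum_grunwald (α : ℝ) {z : ℂ} (hz : ‖z‖ < 1) :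
    HasSum (fun k => (grunwald α k : ℂ) * z ^ k) ((1 - z) ^ (α : ℂ)) := by
  have h := (Complex.one_add_cpow_hasFPowerSeriesOnBall_zero (a := (α : ℂ))).hasSum (y := -z)
    (by simpa [enorm_eq_nnnorm, ← NNReal.coe_lt_one] using hz)
  rw [zero_add, ← sub_eq_add_neg] at h
  refine h.congr_fun fun k => ?_
  rw [binomialSeries_apply, choose_eq_grunwald, List.ofFn_const, List.prod_replicate, smul_eq_mul,
    neg_pow z]
  have : ((-1 : ℂ) ^ k) * (-1) ^ k = 1 := by rw [← mul_pow]; simp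
  linear_combination (-(grunwald α k : ℂ) * z ^ k) * this

theorem hasSum_weight (α : ℝ) {z : ℂ} (hz : ‖z‖ < 1) :
    HasSum (fun k => (weight α k : ℂ) * z ^ k)
      ((1 - z) ^ (α : ℂ) * (mu1 α + mu0 α * z + muNeg1 α * z ^ 2)) := by
  have h := hasSum_grunwald α hz
  have h0 := h.mul_left (mu1 α : ℂ)
  have h1 := h.mul_left (mu0 α * z : ℂ)
  have h2 := h.mul_left (muNeg1 α * z ^ 2 : ℂ)
  -- The three series are aligned at index `k + 2`, where `weight` has its uniform formula.
  rw [← hasSum_nat_add_iff' 2] at h0 ⊢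
  rw [← hasSum_nat_add_iff' 1] at h1
  have := (h0.add h1).add h2
  convert this using 1
  · funext k
    simp only [weight]
    push_cast
    ring
  · simp only [Finset.sum_range_succ, Finset.range_zero, Finset.sum_empty, weight]
    push_cast
    ring

end CNQuasiCompact
end

/-! ### The Peano kernel of the truncation error is `O(h⁴)`. -/

noncomputable section
namespace CNQuasiCompact

open Filter Topology Complex MeasureTheory

/-- Truncation error of the quasi-compact operator on the truncated power `x₊⁶ / 6!`,
with the sum over the weights cut at `K`. -/
def kernelError (α h : ℝ) (K : ℕ) (y : ℝ) : ℝ :=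
  1 / h ^ α * ∑ k ∈ Finset.range K, weight α k * truncPow 6 (y + (1 - k) * h)
    - ((1 - 2 * b2 α) * truncPow (6 - α) y
      + b2 α * (truncPow (6 - α) (y - h) + truncPow (6 - α) (y + h)))

theorem norm_exp_lineOne_mul (ξ y : ℝ) : ‖exp (lineOne ξ * y)‖ = Real.exp y := by
  rw [Complex.norm_exp]
  congr 1
  simp [lineOne_re]

theorem integrable_exp_mul_lineOne_cpow {r : ℝ} (hr : 1 < r) (y : ℝ) :
    Integrable fun ξ => exp (lineOne ξ * y) * lineOne ξ ^ (-(r : ℂ)) := by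
  refine (integrable_lineOne_cpow hr).bdd_mul (c := Real.exp y) ?_ ?_
  · have := continuous_lineOne
    exact Continuous.aestronglyMeasurable (by fun_prop)
  · exact Eventually.of_forall fun ξ => (norm_exp_lineOne_mul ξ y).le

/-- A shift by `(1 - k)h` multiplies the integrand by `e^(hs) z^k` with `z = e^(-hs)`. On `Re s = 1`
one has `|z| = e^(-h) < 1`, so the series converges geometrically, may be exchanged with the
integral, and is summed by `hasSum_weight`. -/
theorem sum_weight_truncPow_eq_integral {α h : ℝ} (hα : 1 < α) (hα' : α ≤ 2) (hh : 0 < h) (K : ℕ)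
    (y : ℝ) (hK : ∀ k : ℕ, K ≤ k → y + (1 - k) * h ≤ 0) :
    ((∑ k ∈ Finset.range K, weight α k * truncPow 6 (y + (1 - k) * h) : ℝ) : ℂ)
      = ∫ ξ, exp (lineOne ξ * y) * lineOne ξ ^ (-((7 : ℝ) : ℂ)) *
        ((1 - exp (-(h * lineOne ξ))) ^ (α : ℂ) * (mu1 α * exp (h * lineOne ξ) + mu0 α
          + muNeg1 α * exp (-(h * lineOne ξ)))) := by
  set F : ℕ → ℝ → ℂ := fun k ξ => weight α k *
    (exp (lineOne ξ * ((y + (1 - k) * h : ℝ) : ℂ)) * lineOne ξ ^ (-((7 : ℝ) : ℂ))) with hF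
  have hFint : ∀ k, Integrable (F k) := fun k =>
    (integrable_exp_mul_lineOne_cpow (by norm_num) _).const_mul _
  have hFval : ∀ k, ∫ ξ, F k ξ = ((weight α k * truncPow 6 (y + (1 - k) * h) : ℝ) : ℂ) := fun k => by
    simp only [hF]
    rw [integral_const_mul]
    push_cast
    rw [truncPow_eq_integral (by norm_num)]
    norm_num
  set c : ℝ := ∫ ξ, ‖lineOne ξ‖ ^ (-7 : ℝ) with hc
  have hFnorm : ∀ k, ∫ ξ, ‖F k ξ‖ = |weight α k| * Real.exp (y + (1 - k) * h) * c := fun k => by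
    simp only [hF, norm_mul, norm_exp_lineOne_mul]
    rw [hc, ← integral_const_mul]
    refine integral_congr_ae (Eventually.of_forall fun ξ => ?_)
    simp only
    rw [← ofReal_neg, norm_cpow_real, norm_real, Real.norm_eq_abs]
    ring
  have hc0 : 0 ≤ c := integral_nonneg fun ξ => by positivity
  have hFsum : Summable fun k => ∫ ξ, ‖F k ξ‖ := by
    have hgeo : Summable fun k : ℕ => Real.exp (-h) ^ k :=
      summable_geometric_of_lt_one (Real.exp_pos _).le (Real.exp_lt_one_iff.2 (by linarith))
    refine Summable.of_nonneg_of_le (fun k => integral_nonneg fun ξ => norm_nonneg _) (fun k => ?_)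
      (hgeo.mul_left (2 * (|mu1 α| + |mu0 α| + |muNeg1 α|) * Real.exp (y + h) * c))
    rw [hFnorm]
    have e : Real.exp (y + (1 - k) * h) = Real.exp (y + h) * Real.exp (-h) ^ k := by
      rw [← Real.exp_nat_mul, ← Real.exp_add]
      congr 1
      ring
    rw [e]
    have := abs_weight_le hα hα' k
    have h1 : 0 ≤ Real.exp (y + h) * Real.exp (-h) ^ k * c := by positivity
    calc _ = |weight α k| * (Real.exp (y + h) * Real.exp (-h) ^ k * c) := by ring
      _ ≤ 2 * (|mu1 α| + |mu0 α| + |muNeg1 α|) * (Real.exp (y + h) * Real.exp (-h) ^ k * c) := by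
        gcongr
      _ = _ := by ring
  have h1 := hasSum_integral_of_summable_integral_norm hFint hFsum
  -- By `hK` the terms with `k ≥ K` vanish, so the finite sum is the whole series.
  have h2 : HasSum (fun k => ∫ ξ, F k ξ)
      ((∑ k ∈ Finset.range K, weight α k * truncPow 6 (y + (1 - k) * h) : ℝ) : ℂ) := by
    rw [ofReal_sum, Finset.sum_congr rfl fun k _ => (hFval k).symm]
    refine hasSum_sum_of_ne_finset_zero fun k hk => ?_
    rw [hFval, truncPow_of_nonpos (by norm_num) (hK k (by simpa using hk))]
    simp
  rw [h2.unique h1]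
  refine integral_congr_ae (Eventually.of_forall fun ξ => ?_)
  simp only
  set z : ℂ := exp (-(h * lineOne ξ)) with hz
  have hz1 : ‖z‖ < 1 := by
    rw [hz, Complex.norm_exp, Real.exp_lt_one_iff]
    simpa [lineOne_re] using hh
  have hz2 : z * exp (h * lineOne ξ) = 1 := by
    rw [hz, ← Complex.exp_add]
    simp
  have hw := (hasSum_weight α hz1).mul_left
    (exp (lineOne ξ * y) * lineOne ξ ^ (-((7 : ℝ) : ℂ)) * exp (h * lineOne ξ))
  have hF' : (fun k => F k ξ) = fun k => exp (lineOne ξ * y) * lineOne ξ ^ (-((7 : ℝ) : ℂ))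
      * exp (h * lineOne ξ) * ((weight α k : ℂ) * z ^ k) := by
    funext k
    have e : exp (lineOne ξ * ((y + (1 - k) * h : ℝ) : ℂ))
        = exp (lineOne ξ * y) * exp (h * lineOne ξ) * z ^ k := by
      rw [hz, ← Complex.exp_nat_mul, ← Complex.exp_add, ← Complex.exp_add]
      congr 1
      push_cast
      ring
    simp only [hF]
    rw [e]
    ring
  rw [hF', hw.tsum_eq]
  linear_combination (exp (lineOne ξ * y) * lineOne ξ ^ (-((7 : ℝ) : ℂ)) * (1 - z) ^ (α : ℂ)
    * (mu0 α + muNeg1 α * z)) * hz2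

theorem compact_truncPow_eq_integral {α : ℝ} (hα' : α ≤ 2) (h y : ℝ) :
    (((1 - 2 * b2 α) * truncPow (6 - α) y
      + b2 α * (truncPow (6 - α) (y - h) + truncPow (6 - α) (y + h)) : ℝ) : ℂ)
      = ∫ ξ, exp (lineOne ξ * y) * lineOne ξ ^ (-((7 - α : ℝ) : ℂ)) *
        (1 + b2 α * (exp (h * lineOne ξ) - 2 + exp (-(h * lineOne ξ)))) := by
  have e : ∀ x : ℝ, (truncPow (6 - α) x : ℂ)
      = ∫ ξ, exp (lineOne ξ * x) * lineOne ξ ^ (-((7 - α : ℝ) : ℂ)) := fun x => by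
    rw [truncPow_eq_integral (by linarith), show 6 - α + 1 = 7 - α by ring]
  have hi : ∀ x : ℝ, Integrable fun ξ => exp (lineOne ξ * x) * lineOne ξ ^ (-((7 - α : ℝ) : ℂ)) :=
    integrable_exp_mul_lineOne_cpow (by linarith)
  have hi2 : Integrable fun ξ => exp (lineOne ξ * ((y - h : ℝ) : ℂ))
      * lineOne ξ ^ (-((7 - α : ℝ) : ℂ)) + exp (lineOne ξ * ((y + h : ℝ) : ℂ))
      * lineOne ξ ^ (-((7 - α : ℝ) : ℂ)) := (hi _).add (hi _)
  rw [ofReal_add, ofReal_mul, ofReal_mul, ofReal_add, e, e, e, ← integral_const_mul,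
    ← integral_add (hi _) (hi _), ← integral_const_mul,
    ← integral_add ((hi _).const_mul _) (hi2.const_mul _)]
  refine integral_congr_ae (Eventually.of_forall fun ξ => ?_)
  simp only
  have e1 : exp (lineOne ξ * ((y - h : ℝ) : ℂ)) = exp (lineOne ξ * y) * exp (-(h * lineOne ξ)) := by
    rw [← Complex.exp_add]; congr 1; push_cast; ring
  have e2 : exp (lineOne ξ * ((y + h : ℝ) : ℂ)) = exp (lineOne ξ * y) * exp (h * lineOne ξ) := by
    rw [← Complex.exp_add]; congr 1; push_cast; ring
  rw [e1, e2]
  push_cast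
  ring

theorem ofReal_mul_cpow {h : ℝ} (hh : 0 < h) {s : ℂ} (hs : s ≠ 0) (α : ℝ) :
    ((h : ℂ) * s) ^ (α : ℂ) = ((h ^ α : ℝ) : ℂ) * s ^ (α : ℂ) := by
  have hh' : (h : ℂ) ≠ 0 := by exact_mod_cast hh.ne'
  rw [cpow_def_of_ne_zero (mul_ne_zero hh' hs), Complex.log_ofReal_mul hh hs, add_mul,
    Complex.exp_add, ← cpow_def_of_ne_zero hs, ofReal_cpow hh.le, cpow_def_of_ne_zero hh',
    ofReal_log hh.le]

theorem norm_exp_neg_lineOne_lt {h : ℝ} (hh : 0 < h) (ξ : ℝ) :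
    ‖exp (-(h * lineOne ξ))‖ < 1 := by
  rw [Complex.norm_exp, Real.exp_lt_one_iff]
  simpa [lineOne_re] using hh

theorem norm_exp_ofReal_mul_lineOne (h ξ : ℝ) : ‖exp (h * lineOne ξ)‖ = Real.exp h := by
  rw [Complex.norm_exp]
  simp [lineOne_re]

theorem integrable_discrete_symbol {α h : ℝ} (hα : 1 < α) (hh : 0 < h) (y : ℝ) :
    Integrable fun ξ => exp (lineOne ξ * y) * lineOne ξ ^ (-((7 : ℝ) : ℂ)) *
        ((1 - exp (-(h * lineOne ξ))) ^ (α : ℂ) * (mu1 α * exp (h * lineOne ξ) + mu0 α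
          + muNeg1 α * exp (-(h * lineOne ξ)))) := by
  have hc := continuous_lineOne
  refine (integrable_exp_mul_lineOne_cpow (by norm_num) y).mul_bdd
    (c := 2 ^ α * (|mu1 α| * Real.exp h + |mu0 α| + |muNeg1 α|)) ?_ ?_
  · refine Continuous.aestronglyMeasurable (Continuous.mul ?_ (by fun_prop))
    refine Continuous.cpow (by fun_prop) continuous_const fun ξ => Or.inl ?_
    have h1 := norm_exp_neg_lineOne_lt hh ξ
    have h2 := (abs_le.1 (Complex.abs_re_le_norm (exp (-(h * lineOne ξ))))).2
    rw [sub_re, one_re]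
    linarith
  · refine Eventually.of_forall fun ξ => ?_
    have h1 := (norm_exp_neg_lineOne_lt hh ξ).le
    have h2 := norm_exp_ofReal_mul_lineOne h ξ
    rw [norm_mul, norm_cpow_real]
    gcongr
    · have := norm_sub_le 1 (exp (-(h * lineOne ξ)))
      rw [norm_one] at this
      linarith
    · refine (norm_add₃_le).trans ?_
      rw [norm_mul, norm_mul, norm_real, norm_real, norm_real, h2]
      simp only [Real.norm_eq_abs]
      have := mul_le_mul_of_nonneg_left h1 (abs_nonneg (muNeg1 α))
      linarith

theorem integrable_compact_symbol {α h : ℝ} (hα' : α ≤ 2) (hh : 0 < h) (y : ℝ) :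
    Integrable fun ξ => exp (lineOne ξ * y) * lineOne ξ ^ (-((7 - α : ℝ) : ℂ)) *
        (1 + b2 α * (exp (h * lineOne ξ) - 2 + exp (-(h * lineOne ξ)))) := by
  have hc := continuous_lineOne
  refine (integrable_exp_mul_lineOne_cpow (by linarith) y).mul_bdd
    (c := 1 + |b2 α| * (Real.exp h + 3)) ?_ ?_
  · exact Continuous.aestronglyMeasurable (by fun_prop)
  · refine Eventually.of_forall fun ξ => ?_
    have h1 := (norm_exp_neg_lineOne_lt hh ξ).le
    have h2 := norm_exp_ofReal_mul_lineOne h ξ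
    refine (norm_add_le _ _).trans ?_
    rw [norm_one, norm_mul, norm_real, Real.norm_eq_abs]
    gcongr
    refine (norm_add_le _ _).trans ?_
    have := norm_sub_le (exp (h * lineOne ξ)) 2
    rw [show ‖(2 : ℂ)‖ = 2 by simp] at this
    linarith

/-- The two inversion integrals combine into the symbol at `hs` because `(hs)^α = h^α s^α`. -/
theorem kernelError_eq_integral {α h : ℝ} (hα : 1 < α) (hα' : α ≤ 2) (hh : 0 < h) (K : ℕ)
    (y : ℝ) (hK : ∀ k : ℕ, K ≤ k → y + (1 - k) * h ≤ 0) :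
    (kernelError α h K y : ℂ) = ∫ ξ, ((h ^ α : ℝ) : ℂ)⁻¹ * (exp (lineOne ξ * y)
      * lineOne ξ ^ (-((7 : ℝ) : ℂ)) * symbol α (h * lineOne ξ)) := by
  rw [kernelError, ofReal_sub, ofReal_mul, sum_weight_truncPow_eq_integral hα hα' hh K y hK,
    compact_truncPow_eq_integral hα', one_div, ofReal_inv, ← integral_const_mul,
    ← integral_sub ((integrable_discrete_symbol hα hh y).const_mul _)
      (integrable_compact_symbol hα' hh y)]
  refine integral_congr_ae (Eventually.of_forall fun ξ => ?_)
  have hs := lineOne_ne_zero ξ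
  have hh' : ((h ^ α : ℝ) : ℂ) ≠ 0 := by exact_mod_cast (Real.rpow_pos_of_pos hh α).ne'
  have e : lineOne ξ ^ (-((7 - α : ℝ) : ℂ))
      = lineOne ξ ^ (-((7 : ℝ) : ℂ)) * lineOne ξ ^ (α : ℂ) := by
    rw [← cpow_add _ _ hs]
    congr 1
    push_cast
    ring
  simp only
  rw [e, symbol, ofReal_mul_cpow hh hs]
  field_simp

/-- The truncation error on the kernel is of fourth order, for `α < 2`. -/
theorem abs_kernelError_le_of_lt {α : ℝ} (hα : 1 < α) (hα' : α < 2) (L : ℝ) :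
    ∃ C : ℝ, 0 ≤ C ∧ ∀ h : ℝ, 0 < h → h ≤ L → ∀ y ≤ L, ∀ K : ℕ,
      (∀ k : ℕ, K ≤ k → y + (1 - k) * h ≤ 0) → |kernelError α h K y| ≤ C * h ^ 4 := by
  obtain ⟨C, hC, hsym⟩ := norm_symbol_le (by linarith : 0 ≤ α) L
  -- The majorant is `|s|^(-7) |s|^(α+4) = |s|^(-(3-α))`. Its integrability needs `3 - α > 1`, which
  -- is why `α = 2` is treated apart.
  have hint := integrable_norm_lineOne_rpow (r := 3 - α) (by linarith)
  refine ⟨Real.exp L * C * ∫ ξ, ‖lineOne ξ‖ ^ (-(3 - α)),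
    mul_nonneg (by positivity) (integral_nonneg fun ξ => by positivity),
    fun h hh hL y hy K hK => ?_⟩
  rw [← Real.norm_eq_abs, ← norm_real, kernelError_eq_integral hα hα'.le hh K y hK]
  have hb := (hint.const_mul (Real.exp L * C * h ^ 4))
  refine (norm_integral_le_of_norm_le hb (Eventually.of_forall fun ξ => ?_)).trans_eq ?_
  · have hn : 0 < ‖lineOne ξ‖ := norm_pos_iff.2 (lineOne_ne_zero ξ)
    have h1 := hsym (h * lineOne ξ) (by simpa [lineOne_re] using hh)
      (by simpa [lineOne_re] using hL)
    rw [norm_mul, norm_real, Real.norm_of_nonneg hh.le,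
      Real.mul_rpow hh.le hn.le] at h1
    rw [norm_mul, norm_mul, norm_mul, norm_exp_lineOne_mul, ← ofReal_neg, norm_cpow_real,
      norm_inv, norm_real, Real.norm_of_nonneg (Real.rpow_nonneg hh.le _)]
    have e1 : h ^ (α + 4) = h ^ α * h ^ 4 := by
      rw [Real.rpow_add hh]; congr 1; exact_mod_cast Real.rpow_natCast h 4
    have e2 : ‖lineOne ξ‖ ^ (-(3 - α)) = ‖lineOne ξ‖ ^ (-7 : ℝ) * ‖lineOne ξ‖ ^ (α + 4) := by
      rw [← Real.rpow_add hn]; congr 1; ring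
    rw [e1] at h1
    rw [e2]
    have hhα : 0 < h ^ α := Real.rpow_pos_of_pos hh α
    calc _ ≤ (h ^ α)⁻¹ * (Real.exp L * ‖lineOne ξ‖ ^ (-7 : ℝ)
          * (C * (h ^ α * h ^ 4 * ‖lineOne ξ‖ ^ (α + 4)))) := by gcongr
      _ = _ := by field_simp
  · rw [integral_const_mul]; ring

/-- At `α = 2` the series `(1-z)²` is a polynomial and `μ_0 = μ_{-1} = 0`; the operator is the
centered second difference. -/
theorem weight_two_eq_zero (k : ℕ) : weight 2 (k + 3) = 0 := by
  have h3 : grunwald 2 3 = 0 := by rw [grunwald_three]; norm_num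
  have hz : ∀ k, grunwald 2 (k + 3) = 0 := by
    intro k
    induction k with
    | zero => exact h3
    | succ k ih =>
      have := grunwald_succ 2 (k + 3)
      rw [ih, mul_zero] at this
      exact (mul_eq_zero.1 this).resolve_left (by positivity)
  have m0 : mu0 2 = 0 := by unfold mu0; norm_num
  have m1 : muNeg1 2 = 0 := by unfold muNeg1; norm_num
  simp only [weight]
  rw [m0, m1, hz]
  simp

/-- The truncation error on the kernel is of fourth order, for `α = 2`. -/
theorem abs_kernelError_two_le {h : ℝ} (hh : 0 < h) (y : ℝ) (K : ℕ)
    (hK : ∀ k : ℕ, K ≤ k → y + (1 - k) * h ≤ 0) : |kernelError 2 h K y| ≤ h ^ 4 := by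
  have w0 : weight 2 0 = 1 := by
    norm_num [weight, grunwald_zero, mu1]
  have w1 : weight 2 1 = -2 := by
    norm_num [weight, grunwald_zero, grunwald_one, mu1, mu0]
  have w2 : weight 2 2 = 1 := by
    norm_num [weight, grunwald_zero, grunwald_one, grunwald_two, mu1, mu0, muNeg1]
  have hsum : ∑ k ∈ Finset.range K, weight 2 k * truncPow 6 (y + (1 - k) * h)
      = truncPow 6 (y + h) - 2 * truncPow 6 y + truncPow 6 (y - h) := by
    have h1 : ∑ k ∈ Finset.range K, weight 2 k * truncPow 6 (y + (1 - k) * h)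
        = ∑ k ∈ Finset.range (K + 3), weight 2 k * truncPow 6 (y + (1 - k) * h) := by
      refine Finset.sum_subset (Finset.range_subset_range.2 (by omega)) fun k _ hk => ?_
      rw [truncPow_of_nonpos (by norm_num) (hK k (by simpa using hk)), mul_zero]
    rw [h1, Finset.sum_range_succ', Finset.sum_range_succ', Finset.sum_range_succ',
      Finset.sum_eq_zero fun k _ => by rw [weight_two_eq_zero, zero_mul]]
    simp only [zero_add, Nat.reduceAdd, w0, w1, w2]
    push_cast
    rw [show y + (1 - 2) * h = y - h by ring, show y + (1 - 1) * h = y by ring,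
      show y + (1 - 0) * h = y + h by ring]
    ring
  have t6 : ∀ x, truncPow 6 x = (max x 0) ^ 6 / 720 := fun x => by
    rw [truncPow]
    have : Real.Gamma (6 + 1) = 720 := by
      have := Real.Gamma_nat_eq_factorial 6
      norm_num [Nat.factorial] at this ⊢
    rw [this]
    congr 1
    exact_mod_cast Real.rpow_natCast _ 6
  have t4 : ∀ x, truncPow (6 - 2) x = (max x 0) ^ 4 / 24 := fun x => by
    rw [truncPow]
    have : Real.Gamma (6 - 2 + 1) = 24 := by
      have := Real.Gamma_nat_eq_factorial 4
      norm_num [Nat.factorial] at this ⊢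
    rw [this]
    congr 1
    rw [show (6 - 2 : ℝ) = (4 : ℕ) by norm_num]
    exact Real.rpow_natCast _ 4
  have hb2 : b2 2 = 1 / 12 := by norm_num [b2]
  have h2 : h ^ (2 : ℝ) = h ^ 2 := by exact_mod_cast Real.rpow_natCast h 2
  rw [kernelError, hsum, hb2, h2]
  simp only [t6, t4]
  -- For `y ≥ h` no truncation is active and the error is exactly `-h⁴/240`. For `y ≤ h` the
  -- positive parts are at most `2h`, so each term is separately `O(h⁴)`.
  rcases le_total h y with hy | hy
  · rw [max_eq_left (by linarith : 0 ≤ y + h), max_eq_left (by linarith : 0 ≤ y),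
      max_eq_left (by linarith : 0 ≤ y - h)]
    have : 1 / h ^ 2 * ((y + h) ^ 6 / 720 - 2 * (y ^ 6 / 720) + (y - h) ^ 6 / 720)
        - ((1 - 2 * (1 / 12)) * (y ^ 4 / 24) + 1 / 12 * ((y - h) ^ 4 / 24 + (y + h) ^ 4 / 24))
        = -(h ^ 4 / 240) := by
      field_simp
      ring
    rw [this, abs_neg, abs_of_nonneg (by positivity)]
    linarith [pow_pos hh 4]
  · rw [max_eq_right (by linarith : y - h ≤ 0)]
    set p := max (y + h) 0
    set q := max y 0
    have hp0 : 0 ≤ p := le_max_right _ _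
    have hq0 : 0 ≤ q := le_max_right _ _
    have hp : p ≤ 2 * h := max_le (by linarith) (by linarith)
    have hq : q ≤ h := max_le hy hh.le
    have p6 : p ^ 6 ≤ 64 * h ^ 6 := by
      calc p ^ 6 ≤ (2 * h) ^ 6 := by gcongr
        _ = _ := by ring
    have q6 : q ^ 6 ≤ h ^ 6 := by gcongr
    have p4 : p ^ 4 ≤ 16 * h ^ 4 := by
      calc p ^ 4 ≤ (2 * h) ^ 4 := by gcongr
        _ = _ := by ring
    have q4 : q ^ 4 ≤ h ^ 4 := by gcongr
    have e : 1 / h ^ 2 * (p ^ 6 / 720 - 2 * (q ^ 6 / 720) + 0 ^ 6 / 720)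
        = (p ^ 6 - 2 * q ^ 6) / 720 / h ^ 2 := by ring
    have u1 : (p ^ 6 - 2 * q ^ 6) / 720 / h ^ 2 ≤ h ^ 4 * (64 / 720) := by
      rw [div_le_iff₀ (by positivity)]
      nlinarith [pow_nonneg hq0 6]
    have u2 : -(h ^ 4 * (2 / 720)) ≤ (p ^ 6 - 2 * q ^ 6) / 720 / h ^ 2 := by
      rw [le_div_iff₀ (by positivity)]
      nlinarith [pow_nonneg hp0 6]
    rw [e, abs_le]
    have := pow_nonneg hp0 4
    have := pow_nonneg hq0 4
    have := pow_pos hh 4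
    constructor <;> norm_num <;> linarith

theorem abs_kernelError_le {α : ℝ} (hα : 1 < α) (hα' : α ≤ 2) (L : ℝ) :
    ∃ C : ℝ, 0 ≤ C ∧ ∀ h : ℝ, 0 < h → h ≤ L → ∀ y ≤ L, ∀ K : ℕ,
      (∀ k : ℕ, K ≤ k → y + (1 - k) * h ≤ 0) → |kernelError α h K y| ≤ C * h ^ 4 := by
  rcases hα'.lt_or_eq with h2 | rfl
  · exact abs_kernelError_le_of_lt hα h2 L
  · exact ⟨1, zero_le_one, fun h hh _ y _ K hK => by
      rw [one_mul]; exact abs_kernelError_two_le hh y K hK⟩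

end CNQuasiCompact
end

/-! ### Fractional integrals as convolutions, and fourth order consistency in space. -/

noncomputable section
namespace CNQuasiCompact

open Filter Topology MeasureTheory

theorem hasDerivAt_truncPow {γ : ℝ} (hγ : 0 < γ) (x : ℝ) :
    HasDerivAt (truncPow (γ + 1)) (truncPow γ x) x := by
  have hne : ∀ y ≠ (0 : ℝ), HasDerivAt (truncPow (γ + 1)) (truncPow γ y) y := by
    intro y hy
    rcases lt_or_gt_of_ne hy with h | h
    · rw [truncPow_of_nonpos hγ h.le]
      refine (hasDerivAt_const y (0 : ℝ)).congr_of_eventuallyEq ?_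
      filter_upwards [Iio_mem_nhds h] with z hz
      exact truncPow_of_nonpos (by linarith) (mem_Iio.1 hz).le
    · have h1 := (Real.hasDerivAt_rpow_const (p := γ + 1) (Or.inl h.ne')).div_const
        (Real.Gamma (γ + 1 + 1))
      have e : truncPow γ y = (γ + 1) * y ^ (γ + 1 - 1) / Real.Gamma (γ + 1 + 1) := by
        have : Real.Gamma (γ + 1) ≠ 0 := (Real.Gamma_pos_of_pos (by linarith)).ne'
        rw [truncPow_of_nonneg h.le, Real.Gamma_add_one (by linarith : γ + 1 ≠ 0),
          add_sub_cancel_right]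
        field_simp
      rw [e]
      refine h1.congr_of_eventuallyEq ?_
      filter_upwards [Ioi_mem_nhds h] with z hz
      exact truncPow_of_nonneg (mem_Ioi.1 hz).le
  by_cases hx : x = 0
  · subst hx
    -- At the kink the derivative is the limit of the nearby derivatives.
    exact hasDerivAt_of_hasDerivAt_of_ne hne (continuous_truncPow (by linarith)).continuousAt
      (continuous_truncPow hγ).continuousAt
  · exact hne x hx

theorem truncPow_nonneg {γ : ℝ} (hγ : 0 < γ) (x : ℝ) : 0 ≤ truncPow γ x :=
  div_nonneg (Real.rpow_nonneg (le_max_right _ _) _) (Real.Gamma_pos_of_pos (by linarith)).le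

theorem truncPow_mono {γ : ℝ} (hγ : 0 < γ) : Monotone (truncPow γ) := fun x y hxy => by
  unfold truncPow
  have := Real.Gamma_pos_of_pos (by linarith : 0 < γ + 1)
  gcongr

/-- Convolution of a function on `[a, b]` with the truncated power of exponent `γ`. -/
def truncPowConv (a b γ : ℝ) (w : ℝ → ℝ) (x : ℝ) : ℝ :=
  ∫ s in a..b, truncPow γ (x - s) * w s

theorem continuousOn_truncPow_mul {a b γ : ℝ} (hγ : 0 < γ) {w : ℝ → ℝ}
    (hw : ContinuousOn w (Icc a b)) (x : ℝ) :
    ContinuousOn (fun s => truncPow γ (x - s) * w s) (Icc a b) :=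
  ((continuous_truncPow hγ).comp (continuous_const.sub continuous_id)).continuousOn.mul hw

theorem intervalIntegrable_truncPow_mul {a b γ : ℝ} (hab : a ≤ b) (hγ : 0 < γ) {w : ℝ → ℝ}
    (hw : ContinuousOn w (Icc a b)) (x : ℝ) :
    IntervalIntegrable (fun s => truncPow γ (x - s) * w s) volume a b :=
  (continuousOn_truncPow_mul hγ hw x).intervalIntegrable_of_Icc hab

theorem aestronglyMeasurable_truncPow_mul {a b γ : ℝ} (hab : a ≤ b) (hγ : 0 < γ) {w : ℝ → ℝ}
    (hw : ContinuousOn w (Icc a b)) (x : ℝ) :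
    AEStronglyMeasurable (fun s => truncPow γ (x - s) * w s) (volume.restrict (uIoc a b)) := by
  rw [uIoc_of_le hab]
  exact ((continuousOn_truncPow_mul hγ hw x).mono Ioc_subset_Icc_self).aestronglyMeasurable
    measurableSet_Ioc

theorem hasDerivAt_truncPowConv {a b γ : ℝ} (hab : a ≤ b) (hγ : 0 < γ) {w : ℝ → ℝ}
    (hw : ContinuousOn w (Icc a b)) (x : ℝ) :
    HasDerivAt (truncPowConv a b (γ + 1) w) (truncPowConv a b γ w x) x := by
  have hγ' : 0 < γ + 1 := by linarith
  refine (intervalIntegral.hasDerivAt_integral_of_dominated_loc_of_deriv_le (μ := volume)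
    (F := fun x s => truncPow (γ + 1) (x - s) * w s) (F' := fun x s => truncPow γ (x - s) * w s)
    (bound := fun s => truncPow γ (x + 1 - a) * |w s|) (Metric.ball_mem_nhds x one_pos)
    (Eventually.of_forall fun y => aestronglyMeasurable_truncPow_mul hab hγ' hw y)
    (intervalIntegrable_truncPow_mul hab hγ' hw x)
    (aestronglyMeasurable_truncPow_mul hab hγ hw x) (Eventually.of_forall fun s hs y hy => ?_)
    ((hw.abs.intervalIntegrable_of_Icc hab).const_mul _)
    (Eventually.of_forall fun s _ y _ => ?_)).2
  · rw [uIoc_of_le hab] at hs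
    rw [Real.norm_eq_abs, abs_mul, abs_of_nonneg (truncPow_nonneg hγ _)]
    have : y < x + 1 := by
      have := (abs_lt.1 (by simpa [Real.dist_eq] using hy : |y - x| < 1)).2
      linarith
    exact mul_le_mul_of_nonneg_right (truncPow_mono hγ (by linarith [hs.1])) (abs_nonneg _)
  · exact ((hasDerivAt_truncPow hγ (y - s)).comp_sub_const y s).mul_const _

theorem continuous_truncPowConv {a b γ : ℝ} (hab : a ≤ b) (hγ : 1 < γ) {w : ℝ → ℝ}
    (hw : ContinuousOn w (Icc a b)) : Continuous (truncPowConv a b γ w) := by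
  refine continuous_iff_continuousAt.2 fun x => ?_
  have := hasDerivAt_truncPowConv hab (by linarith : 0 < γ - 1) hw x
  rw [sub_add_cancel] at this
  exact this.continuousAt

theorem iteratedDeriv_truncPowConv {a b γ : ℝ} (hab : a ≤ b) (hγ : 0 < γ) {w : ℝ → ℝ}
    (hw : ContinuousOn w (Icc a b)) (n : ℕ) :
    iteratedDeriv n (truncPowConv a b (γ + n) w) = truncPowConv a b γ w := by
  induction n with
  | zero => simp
  | succ n ih =>
    have e : deriv (truncPowConv a b (γ + (n + 1 : ℕ)) w) = truncPowConv a b (γ + n) w := by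
      funext x
      push_cast
      rw [← add_assoc]
      exact (hasDerivAt_truncPowConv hab (by positivity) hw x).deriv
    rw [iteratedDeriv_succ', e, ih]

/-- The Riemann–Liouville integral of order `β` with base point `a`. -/
def fracInt (a β : ℝ) (w : ℝ → ℝ) (x : ℝ) : ℝ :=
  (Real.Gamma β)⁻¹ * ∫ s in a..x, (x - s) ^ (β - 1) * w s

/-- The truncated power vanishes for `s ≥ x`, so the moving end point may be replaced by `b`;
differentiation then takes place under an integral with fixed limits. -/
theorem fracInt_eq_truncPowConv {a b γ : ℝ} (hγ : 0 < γ) {w : ℝ → ℝ}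
    (hw : ContinuousOn w (Icc a b)) {x : ℝ} (hx : x ∈ Icc a b) :
    fracInt a (γ + 1) w x = truncPowConv a b γ w x := by
  have hc := continuousOn_truncPow_mul hγ hw x
  rw [truncPowConv, ← intervalIntegral.integral_add_adjacent_intervals (b := x)
    ((hc.mono (Icc_subset_Icc_right hx.2)).intervalIntegrable_of_Icc hx.1)
    ((hc.mono (Icc_subset_Icc_left hx.1)).intervalIntegrable_of_Icc hx.2)]
  have h2 : ∫ s in x..b, truncPow γ (x - s) * w s = 0 := by
    rw [← intervalIntegral.integral_zero (μ := volume) (a := x) (b := b)]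
    refine intervalIntegral.integral_congr fun s hs => ?_
    rw [uIcc_of_le hx.2] at hs
    rw [truncPow_of_nonpos hγ (by linarith [hs.1]), zero_mul]
  rw [h2, add_zero, fracInt, ← intervalIntegral.integral_const_mul]
  refine intervalIntegral.integral_congr fun s hs => ?_
  rw [uIcc_of_le hx.1] at hs
  rw [truncPow_of_nonneg (by linarith [hs.2]), add_sub_cancel_right]
  ring

/-- Integration by parts: the primitive `-(x-s)^β/β` vanishes at `s = x`, and `w a = 0` removes the
other boundary term. For `β < 1` the kernel is singular at `x` but integrable. -/
theorem fracInt_eq_fracInt_deriv {a β x : ℝ} (hβ : 0 < β) (hx : a ≤ x) {w w' : ℝ → ℝ}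
    (hw : ContinuousOn w (Icc a x)) (hw' : ContinuousOn w' (Icc a x))
    (hd : ∀ s ∈ Ioo a x, HasDerivAt w (w' s) s) (h0 : w a = 0) :
    fracInt a β w x = fracInt a (β + 1) w' x := by
  have hG : Real.Gamma β ≠ 0 := (Real.Gamma_pos_of_pos hβ).ne'
  have hu : ∀ s ∈ Ioo a x, HasDerivAt (fun s => -((x - s) ^ β / β)) ((x - s) ^ (β - 1)) s := by
    intro s hs
    have hxs : x - s ≠ 0 := by linarith [hs.2]
    have := ((((hasDerivAt_id s).const_sub x).rpow_const (p := β) (Or.inl hxs)).div_const β).neg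
    refine this.congr_deriv ?_
    simp only [id]
    field_simp
  have huc : Continuous fun s => -((x - s) ^ β / β) :=
    (((continuous_const.sub continuous_id).rpow_const fun _ => Or.inr hβ.le).div_const β).neg
  have hint : IntervalIntegrable (fun s => (x - s) ^ (β - 1)) volume a x := by
    have := (intervalIntegral.intervalIntegrable_rpow' (a := x - a) (b := x - x)
      (r := β - 1) (by linarith)).comp_sub_left x
    simpa using this
  have key := intervalIntegral.integral_deriv_mul_eq_sub_of_hasDerivAt (a := a) (b := x)
    (u := fun s => -((x - s) ^ β / β)) (v := w) huc.continuousOn (by rwa [uIcc_of_le hx])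
    (by rwa [min_eq_left hx, max_eq_right hx]) (by rwa [min_eq_left hx, max_eq_right hx])
    hint (hw'.intervalIntegrable_of_Icc hx)
  simp only [sub_self, Real.zero_rpow hβ.ne', h0, zero_div, neg_zero, zero_mul, mul_zero] at key
  rw [intervalIntegral.integral_add (hint.mul_continuousOn (by rwa [uIcc_of_le hx]))
    ((hw'.intervalIntegrable_of_Icc hx).continuousOn_mul huc.continuousOn)] at key
  have h1 : ∫ s in a..x, -((x - s) ^ β / β) * w' s = -(β⁻¹ * ∫ s in a..x, (x - s) ^ β * w' s) := by
    rw [← intervalIntegral.integral_const_mul, ← intervalIntegral.integral_neg]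
    congr 1
    funext s
    ring
  rw [h1] at key
  rw [fracInt, fracInt, Real.Gamma_add_one hβ.ne', add_sub_cancel_right, mul_inv, mul_comm β⁻¹,
    mul_assoc]
  congr 1
  linarith

/-- A chain `g 0, g 1, …, g n` of successive derivatives on `[a, b]` vanishing at `a`
up to order `n - 1`. -/
structure DerivChain (a b : ℝ) (n : ℕ) (g : ℕ → ℝ → ℝ) : Prop where
  continuousOn : ∀ k ≤ n, ContinuousOn (g k) (Icc a b)
  hasDerivAt : ∀ k < n, ∀ x ∈ Ioo a b, HasDerivAt (g k) (g (k + 1) x) x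
  base : ∀ k < n, g k a = 0

theorem DerivChain.fracInt_eq {a b β : ℝ} {n : ℕ} {g : ℕ → ℝ → ℝ} (hg : DerivChain a b n g)
    (hβ : 0 < β) {x : ℝ} (hx : x ∈ Icc a b) (k m : ℕ) (hkm : k + m ≤ n) :
    fracInt a β (g k) x = fracInt a (β + m) (g (k + m)) x := by
  induction m with
  | zero => simp
  | succ m ih =>
    rw [ih (by omega), fracInt_eq_fracInt_deriv (w' := g (k + m + 1)) (by positivity) hx.1
      ((hg.continuousOn _ (by omega)).mono (Icc_subset_Icc_right hx.2))
      ((hg.continuousOn _ (by omega)).mono (Icc_subset_Icc_right hx.2))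
      (fun s hs => hg.hasDerivAt _ (by omega) s ⟨hs.1, hs.2.trans_le hx.2⟩)
      (hg.base _ (by omega))]
    push_cast
    rw [add_assoc β, add_assoc k]

/-- Taylor's formula at `a` with integral remainder, all Taylor coefficients being zero. -/
theorem DerivChain.eq_truncPowConv {a b : ℝ} {g : ℕ → ℝ → ℝ} (hg : DerivChain a b 7 g)
    {x : ℝ} (hx : x ∈ Icc a b) : g 0 x = truncPowConv a b 6 (g 7) x := by
  have h1 : fracInt a 1 (g 1) x = g 0 x := by
    have := intervalIntegral.integral_eq_sub_of_hasDerivAt_of_le hx.1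
      ((hg.continuousOn 0 (by norm_num)).mono (Icc_subset_Icc_right hx.2))
      (fun s hs => hg.hasDerivAt 0 (by norm_num) s ⟨hs.1, hs.2.trans_le hx.2⟩)
      (((hg.continuousOn 1 (by norm_num)).mono
        (Icc_subset_Icc_right hx.2)).intervalIntegrable_of_Icc hx.1)
    rw [hg.base 0 (by norm_num), sub_zero] at this
    simp [fracInt, ← this]
  rw [← h1, hg.fracInt_eq one_pos hx 1 6 (by norm_num),
    ← fracInt_eq_truncPowConv (by norm_num) (hg.continuousOn 7 le_rfl) hx]
  norm_num

/-- The left Riemann–Liouville derivative of a function with seven derivatives vanishing at the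
base point. -/
theorem DerivChain.leftRL_eq {a b α : ℝ} {g : ℕ → ℝ → ℝ} (hg : DerivChain a b 7 g)
    (hα' : α ≤ 2) {v : ℝ → ℝ} (hv : ∀ x ∈ Icc a b, v x = g 0 x) {x : ℝ}
    (hx : x ∈ Ioo a b) : leftRL a α v x = truncPowConv a b (6 - α) (g 7) x := by
  set n : ℕ := ⌊α⌋₊ + 1 with hn
  have hnα : 0 < (n : ℝ) - α := by
    have := Nat.lt_floor_add_one α
    rw [hn]
    push_cast
    linarith
  have hG : Real.Gamma ((n : ℝ) - α) ≠ 0 := (Real.Gamma_pos_of_pos hnα).ne'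
  have hab : a ≤ b := (hx.1.trans hx.2).le
  -- Seven integrations by parts raise the order from `n - α` to `n - α + 7`, that is, to exponent
  -- `6 - α + n`; the `n` derivatives then lower it to `6 - α`.
  have hev : (fun y => ∫ s in a..y, (y - s) ^ ((n : ℝ) - α - 1) * v s) =ᶠ[𝓝 x]
      fun y => Real.Gamma ((n : ℝ) - α) * truncPowConv a b (6 - α + n) (g 7) y := by
    filter_upwards [Icc_mem_nhds hx.1 hx.2] with y hy
    have h1 := hg.fracInt_eq hnα hy 0 7 (by norm_num)
    rw [show (n : ℝ) - α + (7 : ℕ) = (6 - α + n) + 1 by push_cast; ring, zero_add,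
      fracInt_eq_truncPowConv (by linarith) (hg.continuousOn 7 le_rfl) hy] at h1
    rw [← h1, fracInt, mul_inv_cancel_left₀ hG]
    refine intervalIntegral.integral_congr fun s hs => ?_
    rw [uIcc_of_le hy.1] at hs
    rw [hv s ⟨hs.1, hs.2.trans hy.2⟩]
  unfold leftRL
  rw [← hn, hev.iteratedDeriv_eq n]
  have h2 : (fun y => Real.Gamma ((n : ℝ) - α) * truncPowConv a b (6 - α + n) (g 7) y)
      = Real.Gamma ((n : ℝ) - α) • truncPowConv a b (6 - α + n) (g 7) := by
    funext y; simp
  rw [h2, iteratedDeriv_const_smul_field, smul_eq_mul, inv_mul_cancel_left₀ hG,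
    iteratedDeriv_truncPowConv hab (by linarith) (hg.continuousOn 7 le_rfl)]

/-- Using four space derivatives instead of seven leaves room for two time derivatives in the
midpoint estimate. -/
theorem DerivChain.truncPowConv_eq {a b α : ℝ} {g : ℕ → ℝ → ℝ} (hg : DerivChain a b 7 g)
    (hα' : α ≤ 2) {x : ℝ} (hx : x ∈ Icc a b) :
    truncPowConv a b (6 - α) (g 7) x = truncPowConv a b (3 - α) (g 4) x := by
  rw [← fracInt_eq_truncPowConv (by linarith) (hg.continuousOn 7 le_rfl) hx,
    ← fracInt_eq_truncPowConv (by linarith) (hg.continuousOn 4 (by norm_num)) hx,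
    hg.fracInt_eq (by linarith) hx 4 3 (by norm_num)]
  norm_num
  congr 1
  ring

theorem abs_truncPowConv_le {a b γ G : ℝ} (hab : a ≤ b) (hγ : 0 < γ) {w : ℝ → ℝ}
    (hG : ∀ s ∈ Icc a b, |w s| ≤ G) {x : ℝ} (hx : x ∈ Icc a b) :
    |truncPowConv a b γ w x| ≤ truncPow γ (b - a) * G * (b - a) := by
  have := intervalIntegral.norm_integral_le_of_norm_le_const (a := a) (b := b)
    (f := fun s => truncPow γ (x - s) * w s) (C := truncPow γ (b - a) * G) fun s hs => by
      rw [uIoc_of_le hab] at hs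
      rw [Real.norm_eq_abs, abs_mul, abs_of_nonneg (truncPow_nonneg hγ _)]
      exact mul_le_mul (truncPow_mono hγ (by linarith [hs.1, hx.2])) (hG s ⟨hs.1.le, hs.2⟩)
        (abs_nonneg _) (truncPow_nonneg hγ _)
  rwa [abs_of_nonneg (by linarith), Real.norm_eq_abs] at this

/-- Fourth order consistency of the left quasi-compact operator. -/
theorem exists_leftDiscrete_consistency {a b α : ℝ} (hab : a < b) (hα : 1 < α) (hα' : α ≤ 2) :
    ∃ C : ℝ, 0 ≤ C ∧ ∀ (w : ℝ → ℝ) (G : ℝ), ContinuousOn w (Icc a b) →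
      (∀ s ∈ Icc a b, |w s| ≤ G) → ∀ (M j : ℕ) (h : ℝ), h = (b - a) / M → 1 ≤ j → j < M →
      |leftDiscrete α h (fun i => truncPowConv a b 6 w (a + i * h)) j
        - Px α h (fun i => truncPowConv a b (6 - α) w (a + i * h)) j| ≤ C * G * h ^ 4 := by
  obtain ⟨C, hC, hker⟩ := abs_kernelError_le hα hα' (b - a)
  refine ⟨C * (b - a), mul_nonneg hC (by linarith), fun w G hw hG M j h hh hj hjM => ?_⟩
  have hM : (0 : ℝ) < M := by exact_mod_cast (by omega : 0 < M)
  have hM1 : (1 : ℝ) ≤ M := by exact_mod_cast (by omega : 1 ≤ M)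
  have hh0 : 0 < h := by rw [hh]; exact div_pos (by linarith) hM
  have hhM : M * h = b - a := by rw [hh]; field_simp
  have hhL : h ≤ b - a := by nlinarith
  have hjM' : (j : ℝ) ≤ M := by exact_mod_cast hjM.le
  have hi6 : ∀ x, IntervalIntegrable (fun s => truncPow 6 (x - s) * w s) volume a b :=
    intervalIntegrable_truncPow_mul hab.le (by norm_num) hw
  have hiα : ∀ x, IntervalIntegrable (fun s => truncPow (6 - α) (x - s) * w s) volume a b :=
    intervalIntegrable_truncPow_mul hab.le (by linarith) hw
  -- Both operators are linear and pass under the integral, so the error is a convolution with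
  -- `kernelError`.
  have key : leftDiscrete α h (fun i => truncPowConv a b 6 w (a + i * h)) j
        - Px α h (fun i => truncPowConv a b (6 - α) w (a + i * h)) j
      = ∫ s in a..b, kernelError α h (j + 2) (a + j * h - s) * w s := by
    rw [Px_eq hh0.ne']
    have e1 : leftDiscrete α h (fun i => truncPowConv a b 6 w (a + i * h)) j
        = ∫ s in a..b, 1 / h ^ α * ∑ k ∈ Finset.range (j + 2),
          weight α k * (truncPow 6 (a + (j + 1 - k : ℕ) * h - s) * w s) := by
      rw [intervalIntegral.integral_const_mul, intervalIntegral.integral_finsetSum fun k _ =>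
        (hi6 _).const_mul _]
      simp only [intervalIntegral.integral_const_mul]
      rfl
    rw [e1]
    simp only [truncPowConv]
    rw [← intervalIntegral.integral_const_mul, ← intervalIntegral.integral_add (hiα _) (hiα _),
      ← intervalIntegral.integral_const_mul, ← intervalIntegral.integral_add
        ((hiα _).const_mul _) (((hiα _).add (hiα _)).const_mul _),
      ← intervalIntegral.integral_sub ?_ (((hiα _).const_mul _).add
        (((hiα _).add (hiα _)).const_mul _))]
    · refine intervalIntegral.integral_congr fun s _ => ?_
      have e2 : ∑ k ∈ Finset.range (j + 2),
          weight α k * (truncPow 6 (a + (j + 1 - k : ℕ) * h - s) * w s)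
          = (∑ k ∈ Finset.range (j + 2),
            weight α k * truncPow 6 (a + j * h - s + (1 - k) * h)) * w s := by
        rw [Finset.sum_mul]
        refine Finset.sum_congr rfl fun k hk => ?_
        rw [Finset.mem_range] at hk
        rw [Nat.cast_sub (by omega)]
        push_cast
        rw [show a + ((j : ℝ) + 1 - k) * h - s = a + j * h - s + (1 - k) * h by ring]
        ring
      have e3 : a + ((j - 1 : ℕ) : ℝ) * h - s = a + j * h - s - h := by
        rw [Nat.cast_sub hj]; push_cast; ring
      have e4 : a + ((j + 1 : ℕ) : ℝ) * h - s = a + j * h - s + h := by push_cast; ring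
      rw [e2, e3, e4, kernelError]
      ring
    · refine IntervalIntegrable.const_mul ?_ _
      have := IntervalIntegrable.sum (Finset.range (j + 2)) fun k _ =>
        (hi6 (a + (j + 1 - k : ℕ) * h)).const_mul (weight α k)
      simpa only [Finset.sum_fn] using this
  rw [key]
  have := intervalIntegral.norm_integral_le_of_norm_le_const (a := a) (b := b)
    (f := fun s => kernelError α h (j + 2) (a + j * h - s) * w s) (C := C * h ^ 4 * G)
    fun s hs => by
      rw [uIoc_of_le hab.le] at hs
      rw [Real.norm_eq_abs, abs_mul]
      refine mul_le_mul (hker h hh0 hhL _ ?_ _ fun k hk => ?_) (hG s ⟨hs.1.le, hs.2⟩)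
        (abs_nonneg _) (by positivity)
      · nlinarith [hs.1]
      -- For `k ≥ j + 2` and `s ≥ a` the argument is at most `a - h - s ≤ 0`, so the cut at `j + 2`
      -- loses nothing.
      · have : ((j : ℝ) + 2) ≤ k := by exact_mod_cast hk
        nlinarith [hs.1]
  rw [abs_of_nonneg (by linarith), Real.norm_eq_abs] at this
  linarith

end CNQuasiCompact
end

/-! ### From joint smoothness to consistency in time and space. -/

noncomputable section
namespace CNQuasiCompact

open Filter Topology

/-- Directional derivative within `S` along `e`. -/
def dirDeriv (S : Set (ℝ × ℝ)) (e : ℝ × ℝ) (F : ℝ × ℝ → ℝ) (p : ℝ × ℝ) : ℝ :=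
  fderivWithin ℝ F S p e

theorem contDiffOn_dirDeriv {S : Set (ℝ × ℝ)} (hS : UniqueDiffOn ℝ S) (e : ℝ × ℝ) {F : ℝ × ℝ → ℝ}
    {m : ℕ} (hF : ContDiffOn ℝ (m + 1 : ℕ) F S) : ContDiffOn ℝ m (dirDeriv S e F) S :=
  (hF.fderivWithin hS (by exact_mod_cast le_rfl)).clm_apply contDiffOn_const

theorem contDiffOn_dirDeriv_iterate {S : Set (ℝ × ℝ)} (hS : UniqueDiffOn ℝ S) (e : ℝ × ℝ)
    {F : ℝ × ℝ → ℝ} {m k : ℕ} (hF : ContDiffOn ℝ (m + k : ℕ) F S) :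
    ContDiffOn ℝ m ((dirDeriv S e)^[k] F) S := by
  induction k generalizing m with
  | zero => simpa using hF
  | succ k ih =>
    rw [Function.iterate_succ_apply']
    refine contDiffOn_dirDeriv hS e (ih ?_)
    rwa [show m + 1 + k = m + (k + 1) by omega]

theorem hasDerivWithinAt_fst {I J : Set ℝ} {F : ℝ × ℝ → ℝ} {m : ℕ}
    (hF : ContDiffOn ℝ (m + 1 : ℕ) F (I ×ˢ J)) {x t : ℝ} (hx : x ∈ I) (ht : t ∈ J) :
    HasDerivWithinAt (fun y => F (y, t)) (dirDeriv (I ×ˢ J) (1, 0) F (x, t)) I x := by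
  have h1 : HasFDerivWithinAt F (fderivWithin ℝ F (I ×ˢ J) (x, t)) (I ×ˢ J) (x, t) :=
    (hF.differentiableOn (by norm_num) (x, t) ⟨hx, ht⟩).hasFDerivWithinAt
  have hm : MapsTo (fun y => (y, t)) I (I ×ˢ J) := fun y hy => ⟨hy, ht⟩
  exact h1.comp_hasDerivWithinAt x
    ((hasDerivWithinAt_id x I).prodMk (hasDerivWithinAt_const x I t)) hm

theorem hasDerivWithinAt_snd {I J : Set ℝ} {F : ℝ × ℝ → ℝ} {m : ℕ}
    (hF : ContDiffOn ℝ (m + 1 : ℕ) F (I ×ˢ J)) {x t : ℝ} (hx : x ∈ I) (ht : t ∈ J) :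
    HasDerivWithinAt (fun s => F (x, s)) (dirDeriv (I ×ˢ J) (0, 1) F (x, t)) J t := by
  have h1 : HasFDerivWithinAt F (fderivWithin ℝ F (I ×ˢ J) (x, t)) (I ×ˢ J) (x, t) :=
    (hF.differentiableOn (by norm_num) (x, t) ⟨hx, ht⟩).hasFDerivWithinAt
  have hm : MapsTo (fun s => (x, s)) J (I ×ˢ J) := fun s hs => ⟨hx, hs⟩
  exact h1.comp_hasDerivWithinAt t
    ((hasDerivWithinAt_const t J x).prodMk (hasDerivWithinAt_id t J)) hm

theorem dirDeriv_eq_zero {S : Set (ℝ × ℝ)} {e : ℝ × ℝ} {F : ℝ × ℝ → ℝ} {a : ℝ}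
    (hF : ∀ p ∈ S, p.1 < a → F p = 0) : ∀ p ∈ S, p.1 < a → dirDeriv S e F p = 0 := by
  intro p hp hpa
  have hev : F =ᶠ[𝓝[S] p] fun _ => 0 := by
    have : ∀ᶠ q : ℝ × ℝ in 𝓝 p, q.1 < a := continuous_fst.continuousAt.eventually_lt_const hpa
    filter_upwards [nhdsWithin_le_nhds this, self_mem_nhdsWithin] with q hq hqS
    exact hF q hqS hq
  rw [dirDeriv, hev.fderivWithin_eq (hF p hp hpa)]
  simp

theorem dirDeriv_iterate_eq_zero {S : Set (ℝ × ℝ)} {e : ℝ × ℝ} {F : ℝ × ℝ → ℝ} {a : ℝ}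
    (hF : ∀ p ∈ S, p.1 < a → F p = 0) (k : ℕ) :
    ∀ p ∈ S, p.1 < a → (dirDeriv S e)^[k] F p = 0 := by
  induction k with
  | zero => simpa using hF
  | succ k ih =>
    rw [Function.iterate_succ_apply']
    exact dirDeriv_eq_zero ih

/-- All derivatives vanish to the left of `a`; continuity across `a` then gives zero base values. -/
theorem derivChain_of_contDiffOn {a b : ℝ} (hab : a < b) {J : Set ℝ} {F : ℝ × ℝ → ℝ}
    (hS : UniqueDiffOn ℝ (Iic b ×ˢ J)) {n : ℕ} (hF : ContDiffOn ℝ n F (Iic b ×ˢ J))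
    (h0 : ∀ p ∈ Iic b ×ˢ J, p.1 < a → F p = 0) {t : ℝ} (ht : t ∈ J) :
    DerivChain a b n fun k x => (dirDeriv (Iic b ×ˢ J) (1, 0))^[k] F (x, t) := by
  have hc : ∀ k ≤ n, ContinuousOn (fun x => (dirDeriv (Iic b ×ˢ J) (1, 0))^[k] F (x, t))
      (Iic b) := fun k hk => by
    have := (contDiffOn_dirDeriv_iterate hS (1, 0) (m := 0) (k := k)
      (hF.of_le (by exact_mod_cast (by omega : 0 + k ≤ n)))).continuousOn
    exact this.comp (by fun_prop) fun x hx => ⟨hx, ht⟩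
  refine ⟨fun k hk => (hc k hk).mono Icc_subset_Iic_self, fun k hk x hx => ?_, fun k hk => ?_⟩
  · have h1 := contDiffOn_dirDeriv_iterate hS (1, 0) (m := 0 + 1) (k := k)
      (hF.of_le (by exact_mod_cast (by omega : 0 + 1 + k ≤ n)))
    have h2 := hasDerivWithinAt_fst h1 (mem_Iic.2 hx.2.le) ht
    rw [Function.iterate_succ_apply']
    exact h2.hasDerivAt (Iic_mem_nhds hx.2)
  · have h1 : Tendsto (fun x => (dirDeriv (Iic b ×ˢ J) (1, 0))^[k] F (x, t)) (𝓝[<] a)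
        (𝓝 ((dirDeriv (Iic b ×ˢ J) (1, 0))^[k] F (a, t))) :=
      (hc k hk.le a hab.le).mono_left
        (nhdsWithin_mono a fun x hx => (mem_Iio.1 hx).le.trans hab.le)
    refine tendsto_nhds_unique h1 (tendsto_const_nhds.congr' ?_)
    filter_upwards [self_mem_nhdsWithin] with x hx
    have hx : x < a := hx
    exact (dirDeriv_iterate_eq_zero h0 k (x, t) ⟨hx.le.trans hab.le, ht⟩ hx).symm

theorem abs_sub_le_of_deriv_bound {k c : ℝ} (hk : 0 ≤ k) {ψ ψ' : ℝ → ℝ}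
    (hd : ∀ s ∈ Icc 0 k, HasDerivWithinAt ψ (ψ' s) (Icc 0 k) s)
    (hb : ∀ s ∈ Icc 0 k, |ψ' s| ≤ c) : |ψ k - ψ 0| ≤ c * k := by
  have := Convex.norm_image_sub_le_of_norm_hasDerivWithin_le hd (fun s hs => hb s hs)
    (convex_Icc 0 k) (left_mem_Icc.2 hk) (right_mem_Icc.2 hk)
  simpa [abs_of_nonneg hk] using this

theorem hasDerivWithinAt_comp_add {J : Set ℝ} {φ φ' : ℝ → ℝ} {m k : ℝ}
    (hd : ∀ s ∈ J, HasDerivWithinAt φ (φ' s) J s) (hJ : ∀ s ∈ Icc 0 k, m + s ∈ J) :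
    ∀ s ∈ Icc 0 k, HasDerivWithinAt (fun s => φ (m + s)) (φ' (m + s)) (Icc 0 k) s := by
  intro s hs
  exact ((hd _ (hJ s hs)).comp s ((hasDerivWithinAt_id s (Icc 0 k)).const_add m) hJ).congr_deriv
    (by simp)

theorem hasDerivWithinAt_comp_sub {J : Set ℝ} {φ φ' : ℝ → ℝ} {m k : ℝ}
    (hd : ∀ s ∈ J, HasDerivWithinAt φ (φ' s) J s) (hJ : ∀ s ∈ Icc 0 k, m - s ∈ J) :
    ∀ s ∈ Icc 0 k, HasDerivWithinAt (fun s => φ (m - s)) (-φ' (m - s)) (Icc 0 k) s := by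
  intro s hs
  exact ((hd _ (hJ s hs)).comp s ((hasDerivWithinAt_id s (Icc 0 k)).const_sub m) hJ).congr_deriv
    (by simp)

section Midpoint

variable {T m k c : ℝ} {φ φ₁ φ₂ φ₃ : ℝ → ℝ}

/-- As a function of `k` the expression and its first derivative vanish at `0`; the mean value
inequality is applied twice. The constant is not sharp. -/
theorem abs_add_sub_two_mul_le (hk : 0 ≤ k) (hm : 0 ≤ m - k) (hM : m + k ≤ T)
    (h1 : ∀ s ∈ Icc 0 T, HasDerivWithinAt φ (φ₁ s) (Icc 0 T) s)
    (h2 : ∀ s ∈ Icc 0 T, HasDerivWithinAt φ₁ (φ₂ s) (Icc 0 T) s)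
    (hc : ∀ s ∈ Icc 0 T, |φ₂ s| ≤ c) :
    |φ (m + k) + φ (m - k) - 2 * φ m| ≤ 2 * c * k ^ 2 := by
  have hp : ∀ s ∈ Icc 0 k, m + s ∈ Icc 0 T := fun s hs =>
    ⟨by linarith [hs.1, hs.2], by linarith [hs.1, hs.2]⟩
  have hq : ∀ s ∈ Icc 0 k, m - s ∈ Icc 0 T := fun s hs =>
    ⟨by linarith [hs.1, hs.2], by linarith [hs.1, hs.2]⟩
  have b1 : ∀ s ∈ Icc 0 k, |φ₁ (m + s) + -φ₁ (m - s)| ≤ 2 * c * k := by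
    intro s hs
    have hsub : ∀ r ∈ Icc 0 s, r ∈ Icc 0 k := fun r hr => ⟨hr.1, hr.2.trans hs.2⟩
    have h := abs_sub_le_of_deriv_bound hs.1
      (fun r hr => (hasDerivWithinAt_comp_add h2 (fun r hr => hp r (hsub r hr)) r hr).sub
        (hasDerivWithinAt_comp_sub h2 (fun r hr => hq r (hsub r hr)) r hr))
      (c := 2 * c) (fun r hr => by
        have e1 := abs_le.1 (hc _ (hp r (hsub r hr)))
        have e2 := abs_le.1 (hc _ (hq r (hsub r hr)))
        rw [abs_le]
        constructor <;> linarith)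
    have hc0 : 0 ≤ c := (abs_nonneg _).trans (hc _ (hp s hs))
    simp only [Pi.sub_apply, add_zero, sub_zero, sub_self] at h
    calc _ = |φ₁ (m + s) - φ₁ (m - s)| := by rw [← sub_eq_add_neg]
      _ ≤ 2 * c * s := h
      _ ≤ _ := by gcongr; exact hs.2
  have h := abs_sub_le_of_deriv_bound hk
    (fun s hs => (hasDerivWithinAt_comp_add h1 hp s hs).add (hasDerivWithinAt_comp_sub h1 hq s hs))
    b1
  simp only [Pi.add_apply, add_zero, sub_zero] at h
  calc _ = |φ (m + k) + φ (m - k) - (φ m + φ m)| := by ring_nf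
    _ ≤ _ := h
    _ = _ := by ring

/-- The derivative in `k` is the symmetric second difference of `φ₁`, already bounded by the
preceding lemma. -/
theorem abs_sub_sub_two_mul_le (hk : 0 ≤ k) (hm : 0 ≤ m - k) (hM : m + k ≤ T)
    (h1 : ∀ s ∈ Icc 0 T, HasDerivWithinAt φ (φ₁ s) (Icc 0 T) s)
    (h2 : ∀ s ∈ Icc 0 T, HasDerivWithinAt φ₁ (φ₂ s) (Icc 0 T) s)
    (h3 : ∀ s ∈ Icc 0 T, HasDerivWithinAt φ₂ (φ₃ s) (Icc 0 T) s)
    (hc : ∀ s ∈ Icc 0 T, |φ₃ s| ≤ c) :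
    |φ (m + k) - φ (m - k) - 2 * k * φ₁ m| ≤ 2 * c * k ^ 3 := by
  have hp : ∀ s ∈ Icc 0 k, m + s ∈ Icc 0 T := fun s hs =>
    ⟨by linarith [hs.1, hs.2], by linarith [hs.1, hs.2]⟩
  have hq : ∀ s ∈ Icc 0 k, m - s ∈ Icc 0 T := fun s hs =>
    ⟨by linarith [hs.1, hs.2], by linarith [hs.1, hs.2]⟩
  have b1 : ∀ s ∈ Icc 0 k, |φ₁ (m + s) - -φ₁ (m - s) - 2 * φ₁ m| ≤ 2 * c * k ^ 2 := by
    intro s hs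
    have h := abs_add_sub_two_mul_le (T := T) (m := m) hs.1 (by linarith [hs.2]) (by linarith [hs.2]) h2 h3 hc
    have hc0 : 0 ≤ c := (abs_nonneg _).trans (hc _ (hp s hs))
    rw [sub_neg_eq_add]
    refine h.trans ?_
    have := hs.1
    have := hs.2
    gcongr
  have h := abs_sub_le_of_deriv_bound hk
    (fun s hs => ((hasDerivWithinAt_comp_add h1 hp s hs).sub
      (hasDerivWithinAt_comp_sub h1 hq s hs)).sub
      (((hasDerivWithinAt_id s (Icc 0 k)).const_mul (2 * φ₁ m)).congr_deriv (mul_one _)))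
    b1
  simp only [Pi.sub_apply, add_zero, sub_zero, id, mul_zero, sub_self] at h
  calc _ = |φ (m + k) - φ (m - k) - 2 * φ₁ m * k| := by ring_nf
    _ ≤ _ := h
    _ = _ := by ring

end Midpoint

theorem exists_bound_add_sub_two_mul {a b T : ℝ} {I : Set ℝ} (hI : Icc a b ⊆ I)
    (hS : UniqueDiffOn ℝ (I ×ˢ Icc 0 T)) {F : ℝ × ℝ → ℝ}
    (hF : ContDiffOn ℝ (2 : ℕ) F (I ×ˢ Icc 0 T)) :
    ∃ C, 0 ≤ C ∧ ∀ x ∈ Icc a b, ∀ m k, 0 ≤ k → 0 ≤ m - k → m + k ≤ T →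
      |F (x, m + k) + F (x, m - k) - 2 * F (x, m)| ≤ C * k ^ 2 := by
  have hF1 : ContDiffOn ℝ (1 : ℕ) (dirDeriv (I ×ˢ Icc 0 T) (0, 1) F) (I ×ˢ Icc 0 T) :=
    contDiffOn_dirDeriv hS _ hF
  have hF2 := (contDiffOn_dirDeriv hS (0, 1) (m := 0) hF1).continuousOn
  obtain ⟨c, hc⟩ := (isCompact_Icc.prod isCompact_Icc).exists_bound_of_continuousOn
    (hF2.mono (prod_mono hI (Subset.refl (Icc 0 T))))
  refine ⟨2 * max c 0, by positivity, fun x hx m k hk hm hM => ?_⟩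
  exact abs_add_sub_two_mul_le hk hm hM
    (fun s hs => hasDerivWithinAt_snd (m := 1) hF (hI hx) hs)
    (fun s hs => hasDerivWithinAt_snd (m := 0) hF1 (hI hx) hs)
    (fun s hs => (hc (x, s) ⟨hx, hs⟩).trans (le_max_left _ _))

/-- Consistency in time: midpoint differences of `u` approximate `∂ₜ u = ut`. -/
structure IsTimeConsistent (a b T : ℝ) (u ut : ℝ → ℝ → ℝ) (C : ℝ) : Prop where
  nonneg : 0 ≤ C
  hasDerivWithinAt : ∀ x ∈ Icc a b, ∀ t ∈ Icc 0 T, HasDerivWithinAt (u x) (ut x t) (Icc 0 T) t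
  continuousOn : ∀ t ∈ Icc 0 T, ContinuousOn (fun x => ut x t) (Icc a b)
  midpoint : ∀ x ∈ Icc a b, ∀ m k, 0 ≤ k → 0 ≤ m - k → m + k ≤ T →
    |u x (m + k) - u x (m - k) - 2 * k * ut x m| ≤ C * k ^ 3

theorem zeroExt_of_mem {a b : ℝ} (u : ℝ → ℝ → ℝ) {x : ℝ} (hx : x ∈ Icc a b) (t : ℝ) :
    zeroExt a b u (x, t) = u x t := by
  simp [zeroExt, indicator_of_mem hx]

theorem exists_isTimeConsistent {a b T : ℝ} {I : Set ℝ} (hI : Icc a b ⊆ I)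
    (hS : UniqueDiffOn ℝ (I ×ˢ Icc 0 T)) {u : ℝ → ℝ → ℝ}
    (hF : ContDiffOn ℝ 7 (zeroExt a b u) (I ×ˢ Icc 0 T)) :
    ∃ ut C, IsTimeConsistent a b T u ut C := by
  have hF0 : ContDiffOn ℝ (3 : ℕ) (zeroExt a b u) (I ×ˢ Icc 0 T) :=
    hF.of_le (by exact_mod_cast (by norm_num : (3 : ℕ) ≤ 7))
  have hF1 : ContDiffOn ℝ (2 : ℕ) (dirDeriv (I ×ˢ Icc 0 T) (0, 1) (zeroExt a b u))
    (I ×ˢ Icc 0 T) := contDiffOn_dirDeriv hS _ hF0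
  have hF2 : ContDiffOn ℝ (1 : ℕ) (dirDeriv (I ×ˢ Icc 0 T) (0, 1) (dirDeriv (I ×ˢ Icc 0 T) (0, 1)
    (zeroExt a b u))) (I ×ˢ Icc 0 T) := contDiffOn_dirDeriv hS _ hF1
  have hF3 := (contDiffOn_dirDeriv hS (0, 1) (m := 0) hF2).continuousOn
  obtain ⟨c, hc⟩ := (isCompact_Icc.prod isCompact_Icc).exists_bound_of_continuousOn
    (hF3.mono (prod_mono hI (Subset.refl (Icc 0 T))))
  have hd : ∀ x ∈ Icc a b, ∀ t ∈ Icc 0 T, HasDerivWithinAt (u x)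
      (dirDeriv (I ×ˢ Icc 0 T) (0, 1) (zeroExt a b u) (x, t)) (Icc 0 T) t := fun x hx t ht =>
    (hasDerivWithinAt_snd (m := 2) hF0 (hI hx) ht).congr
      (fun s _ => (zeroExt_of_mem u hx s).symm) (zeroExt_of_mem u hx t).symm
  refine ⟨fun x t => dirDeriv (I ×ˢ Icc 0 T) (0, 1) (zeroExt a b u) (x, t), 2 * max c 0,
    by positivity, hd, fun t ht => ?_, fun x hx m k hk hm hM => ?_⟩
  · exact hF1.continuousOn.comp (by fun_prop) fun x hx => ⟨hI hx, ht⟩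
  · exact abs_sub_sub_two_mul_le hk hm hM (hd x hx)
      (fun s hs => hasDerivWithinAt_snd (m := 1) hF1 (hI hx) hs)
      (fun s hs => hasDerivWithinAt_snd (m := 0) hF2 (hI hx) hs)
      (fun s hs => (hc (x, s) ⟨hx, hs⟩).trans (le_max_left _ _))

/-- Consistency in space: the discrete operator `disc` applied to `u` approximates `P_x D`, where
`D` extends the fractional derivative `RL` continuously to the closed interval. -/
structure IsSpaceConsistent (a b T α : ℝ) (u RL : ℝ → ℝ → ℝ)
    (disc : ℕ → ℝ → (ℕ → ℝ) → ℕ → ℝ) (D : ℝ → ℝ → ℝ) (C : ℝ) : Prop where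
  nonneg : 0 ≤ C
  eq : ∀ x ∈ Ioo a b, ∀ t ∈ Icc 0 T, RL x t = D x t
  continuous : ∀ t ∈ Icc 0 T, Continuous fun x => D x t
  midpoint : ∀ x ∈ Icc a b, ∀ m k, 0 ≤ k → 0 ≤ m - k → m + k ≤ T →
    |D x (m + k) + D x (m - k) - 2 * D x m| ≤ C * k ^ 2
  discrete : ∀ (M j : ℕ) (h : ℝ), h = (b - a) / M → 1 ≤ j → j < M → ∀ t ∈ Icc 0 T,
    |disc M h (fun i => u (a + i * h) t) j - Px α h (fun i => D (a + i * h) t) j| ≤ C * h ^ 4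

theorem exists_isSpaceConsistent_left {a b T α : ℝ} (hab : a < b) (hT : 0 < T) (hα : 1 < α)
    (hα' : α ≤ 2) {u : ℝ → ℝ → ℝ} (hF : ContDiffOn ℝ 7 (zeroExt a b u) (Iic b ×ˢ Icc 0 T)) :
    ∃ D C, IsSpaceConsistent a b T α u (fun x t => leftRL a α (fun y => u y t) x)
      (fun _ h => leftDiscrete α h) D C := by
  have hS : UniqueDiffOn ℝ (Iic b ×ˢ Icc 0 T) := (uniqueDiffOn_Iic b).prod (uniqueDiffOn_Icc hT)
  set g : ℕ → ℝ × ℝ → ℝ := fun k => (dirDeriv (Iic b ×ˢ Icc 0 T) (1, 0))^[k] (zeroExt a b u)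
    with hg
  have hchain : ∀ t ∈ Icc 0 T, DerivChain a b 7 fun k x => g k (x, t) := fun t ht =>
    derivChain_of_contDiffOn hab hS (n := 7) hF (fun p _ hp => by
      rw [zeroExt, indicator_of_notMem fun h => absurd h.1 (not_le.2 hp)]) ht
  have hg7 : ContinuousOn (g 7) (Iic b ×ˢ Icc 0 T) :=
    (contDiffOn_dirDeriv_iterate hS (1, 0) (m := 0) (k := 7) hF).continuousOn
  have hg4 : ContDiffOn ℝ (2 : ℕ) (g 4) (Iic b ×ˢ Icc 0 T) :=
    contDiffOn_dirDeriv_iterate hS (1, 0) (m := 2) (k := 4)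
      (hF.of_le (by exact_mod_cast (by norm_num : (2 + 4 : ℕ) ≤ 7)))
  have hI : Icc a b ⊆ Iic b := Icc_subset_Iic_self
  obtain ⟨G, hG⟩ := (isCompact_Icc.prod isCompact_Icc).exists_bound_of_continuousOn
    (hg7.mono (prod_mono hI (Subset.refl (Icc 0 T))))
  obtain ⟨c, hc0, hc⟩ := exists_bound_add_sub_two_mul (a := a) hI hS hg4
  obtain ⟨C₁, hC₁, hcons⟩ := exists_leftDiscrete_consistency hab hα hα'
  have hγ : 0 < 3 - α := by linarith
  set C₂ := truncPow (3 - α) (b - a) * c * (b - a) with hC₂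
  have hC₂0 : 0 ≤ C₂ := mul_nonneg (mul_nonneg (truncPow_nonneg hγ _) hc0) (by linarith)
  have hC₁0 : 0 ≤ C₁ * max G 0 := by positivity
  refine ⟨fun x t => truncPowConv a b (6 - α) (fun s => g 7 (s, t)) x, C₁ * max G 0 + C₂,
    by positivity, fun x hx t ht => ?_, fun t ht => ?_, fun x hx m k hk hm hM => ?_,
    fun M j h hh hj hjM t ht => ?_⟩
  · exact (hchain t ht).leftRL_eq hα' (fun y hy => (zeroExt_of_mem u hy t).symm) hx
  · exact continuous_truncPowConv hab.le (by linarith) ((hchain t ht).continuousOn 7 le_rfl)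
  · have t1 : m + k ∈ Icc 0 T := ⟨by linarith, hM⟩
    have t2 : m - k ∈ Icc 0 T := ⟨hm, by linarith⟩
    have t3 : m ∈ Icc 0 T := ⟨by linarith, by linarith⟩
    have hi : ∀ t ∈ Icc 0 T, IntervalIntegrable
        (fun s => truncPow (3 - α) (x - s) * g 4 (s, t)) MeasureTheory.volume a b := fun t ht =>
      intervalIntegrable_truncPow_mul hab.le hγ ((hchain t ht).continuousOn 4 (by norm_num)) x
    -- `g 7` is only continuous in time, whereas `g 4` has the two time derivatives needed.
    rw [(hchain _ t1).truncPowConv_eq hα' hx, (hchain _ t2).truncPowConv_eq hα' hx,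
      (hchain _ t3).truncPowConv_eq hα' hx]
    have e : truncPowConv a b (3 - α) (fun s => g 4 (s, m + k)) x
        + truncPowConv a b (3 - α) (fun s => g 4 (s, m - k)) x
        - 2 * truncPowConv a b (3 - α) (fun s => g 4 (s, m)) x
        = truncPowConv a b (3 - α)
          (fun s => g 4 (s, m + k) + g 4 (s, m - k) - 2 * g 4 (s, m)) x := by
      simp only [truncPowConv]
      rw [← intervalIntegral.integral_const_mul, ← intervalIntegral.integral_add (hi _ t1) (hi _ t2),
        ← intervalIntegral.integral_sub ((hi _ t1).add (hi _ t2)) ((hi _ t3).const_mul 2)]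
      congr 1
      funext s
      ring
    rw [e]
    refine (abs_truncPowConv_le hab.le hγ (fun s hs => hc s hs m k hk hm hM) hx).trans ?_
    have : 0 ≤ C₁ * max G 0 * k ^ 2 := by positivity
    have e2 : truncPow (3 - α) (b - a) * (c * k ^ 2) * (b - a) = C₂ * k ^ 2 := by rw [hC₂]; ring
    rw [e2]
    linarith
  · have h1 := hcons (fun s => g 7 (s, t)) (max G 0) ((hchain t ht).continuousOn 7 le_rfl)
      (fun s hs => (hG (s, t) ⟨hs, ht⟩).trans (le_max_left _ _)) M j h hh hj hjM
    have hM : (0 : ℝ) < M := by exact_mod_cast (by omega : 0 < M)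
    have hh0 : 0 < h := by rw [hh]; exact div_pos (by linarith) hM
    have hhM : M * h = b - a := by rw [hh]; field_simp
    have e : leftDiscrete α h (fun i => u (a + i * h) t) j
        = leftDiscrete α h (fun i => truncPowConv a b 6 (fun s => g 7 (s, t)) (a + i * h)) j := by
      refine leftDiscrete_congr α h fun i hi => ?_
      have hiM : (i : ℝ) ≤ M := by exact_mod_cast (by omega : i ≤ M)
      have hmem : a + i * h ∈ Icc a b := ⟨by linarith [mul_nonneg (Nat.cast_nonneg i) hh0.le],
        by nlinarith⟩
      rw [← zeroExt_of_mem u hmem t]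
      exact (hchain t ht).eq_truncPowConv hmem
    rw [e]
    have : 0 ≤ C₂ * h ^ 4 := by positivity
    linarith

theorem zeroExt_reflect (a b : ℝ) (u : ℝ → ℝ → ℝ) (p : ℝ × ℝ) :
    zeroExt a b (fun x t => u (a + b - x) t) p = zeroExt a b u (a + b - p.1, p.2) := by
  have : a + b - p.1 ∈ Icc a b ↔ p.1 ∈ Icc a b := by
    simp only [mem_Icc]
    constructor <;> rintro ⟨h1, h2⟩ <;> constructor <;> linarith
  by_cases h : p.1 ∈ Icc a b
  · simp [zeroExt, indicator_of_mem h, indicator_of_mem (this.2 h)]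
  · rw [zeroExt, zeroExt, indicator_of_notMem h, indicator_of_notMem fun h' => h (this.1 h')]

/-- The sign `(-1)ⁿ` in the definition cancels the one produced by differentiating `n` times through
`y ↦ a + b - y`. -/
theorem rightRL_eq_leftRL_reflect (a b α : ℝ) (v : ℝ → ℝ) (x : ℝ) :
    rightRL b α v x = leftRL a α (fun y => v (a + b - y)) (a + b - x) := by
  unfold rightRL leftRL
  have e : (fun y => ∫ s in y..b, (s - y) ^ (((⌊α⌋₊ + 1 : ℕ) : ℝ) - α - 1) * v s)
      = fun y => (fun z => ∫ s in a..z, (z - s) ^ (((⌊α⌋₊ + 1 : ℕ) : ℝ) - α - 1)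
        * v (a + b - s)) (a + b - y) := by
    funext y
    have := intervalIntegral.integral_comp_sub_left (a := a) (b := a + b - y)
      (fun s => (s - y) ^ (((⌊α⌋₊ + 1 : ℕ) : ℝ) - α - 1) * v s) (a + b)
    rw [show a + b - (a + b - y) = y by ring, show a + b - a = b by ring] at this
    rw [← this]
    congr 1
    funext s
    congr 2
    ring
  rw [e, iteratedDeriv_comp_const_sub (f := fun z => ∫ s in a..z,
    (z - s) ^ (((⌊α⌋₊ + 1 : ℕ) : ℝ) - α - 1) * v (a + b - s))]
  have : ((-1 : ℝ) ^ (⌊α⌋₊ + 1)) * (-1) ^ (⌊α⌋₊ + 1) = 1 := by rw [← mul_pow]; simp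
  simp only [smul_eq_mul]
  linear_combination ((Real.Gamma (((⌊α⌋₊ + 1 : ℕ) : ℝ) - α))⁻¹ * iteratedDeriv (⌊α⌋₊ + 1)
    (fun z => ∫ s in a..z, (z - s) ^ (((⌊α⌋₊ + 1 : ℕ) : ℝ) - α - 1) * v (a + b - s))
    (a + b - x)) * this

theorem exists_isSpaceConsistent_right {a b T α : ℝ} (hab : a < b) (hT : 0 < T) (hα : 1 < α)
    (hα' : α ≤ 2) {u : ℝ → ℝ → ℝ} (hF : ContDiffOn ℝ 7 (zeroExt a b u) (Ici a ×ˢ Icc 0 T)) :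
    ∃ D C, IsSpaceConsistent a b T α u (fun x t => rightRL b α (fun y => u y t) x)
      (fun M h => rightDiscrete α h M) D C := by
  have hF' : ContDiffOn ℝ 7 (zeroExt a b fun x t => u (a + b - x) t) (Iic b ×ˢ Icc 0 T) := by
    have : zeroExt a b (fun x t => u (a + b - x) t)
        = zeroExt a b u ∘ fun p : ℝ × ℝ => (a + b - p.1, p.2) :=
      funext fun p => zeroExt_reflect a b u p
    rw [this]
    refine hF.comp (by fun_prop) fun p hp => ⟨?_, hp.2⟩
    have : p.1 ≤ b := hp.1
    exact mem_Ici.2 (by linarith)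
  obtain ⟨D, C, hD⟩ := exists_isSpaceConsistent_left hab hT hα hα' hF'
  have hmem : ∀ x ∈ Icc a b, a + b - x ∈ Icc a b := fun x hx =>
    ⟨by linarith [hx.2], by linarith [hx.1]⟩
  refine ⟨fun x t => D (a + b - x) t, C, hD.nonneg, fun x hx t ht => ?_, fun t ht => ?_,
    fun x hx => hD.midpoint _ (hmem x hx), fun M j h hh hj hjM t ht => ?_⟩
  · rw [rightRL_eq_leftRL_reflect a]
    exact hD.eq _ ⟨by linarith [hx.2], by linarith [hx.1]⟩ t ht
  · exact (hD.continuous t ht).comp (continuous_const.sub continuous_id)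
  · have h1 := hD.discrete M (M - j) h hh (by omega) (by omega) t ht
    have hM : (0 : ℝ) < M := by exact_mod_cast (by omega : 0 < M)
    have hhM : M * h = b - a := by rw [hh]; field_simp
    have e0 : ∀ i ≤ M, a + b - (a + (i : ℝ) * h) = a + ((M - i : ℕ) : ℝ) * h := fun i hi => by
      rw [Nat.cast_sub hi]
      linarith
    have e1 : rightDiscrete α h M (fun i => u (a + i * h) t) j
        = leftDiscrete α h (fun i => u (a + b - (a + i * h)) t) (M - j) := by
      rw [rightDiscrete_eq_leftDiscrete α h hj hjM.le]
      exact leftDiscrete_congr α h fun i hi => by rw [e0 i (by omega)]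
    have e2 : Px α h (fun i => D (a + b - (a + i * h)) t) j
        = Px α h (fun i => D (a + i * h) t) (M - j) := by
      rw [← Px_reflect α h _ hj hjM]
      refine Px_congr α h fun i hi => ?_
      have h2 := e0 (M - i) (by omega)
      rw [show M - (M - i) = i by omega] at h2
      rw [h2]
    rw [e1, e2]
    exact h1

end CNQuasiCompact
end

/-! ### The residual bound and the convergence theorem. -/

noncomputable section
namespace CNQuasiCompact

/-- Space consistency of the term with coefficient `K`; nothing is required if `K = 0`. -/
theorem exists_scaled_consistency {a b T α K : ℝ} {u RL : ℝ → ℝ → ℝ}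
    {disc : ℕ → ℝ → (ℕ → ℝ) → ℕ → ℝ} (hK : 0 ≤ K)
    (h : K ≠ 0 → ∃ D C, IsSpaceConsistent a b T α u RL disc D C) :
    ∃ (D : ℝ → ℝ → ℝ) (C : ℝ), 0 ≤ C ∧
      (∀ x ∈ Ioo a b, ∀ t ∈ Icc 0 T, K * RL x t = K * D x t) ∧
      (∀ t ∈ Icc 0 T, Continuous fun x => D x t) ∧
      (∀ x ∈ Icc a b, ∀ m k, 0 ≤ k → 0 ≤ m - k → m + k ≤ T →
        |K * (D x (m + k) + D x (m - k) - 2 * D x m)| ≤ C * k ^ 2) ∧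
      ∀ (M j : ℕ) (h : ℝ), h = (b - a) / M → 1 ≤ j → j < M → ∀ t ∈ Icc 0 T,
        |K * (disc M h (fun i => u (a + i * h) t) j - Px α h (fun i => D (a + i * h) t) j)|
          ≤ C * h ^ 4 := by
  by_cases hK0 : K = 0
  · exact ⟨fun _ _ => 0, 0, le_rfl, by simp [hK0], fun _ _ => continuous_const, by simp [hK0],
      by simp [hK0]⟩
  · obtain ⟨D, C, hD⟩ := h hK0
    refine ⟨D, K * C, mul_nonneg hK hD.nonneg, fun x hx t ht => by rw [hD.eq x hx t ht],
      hD.continuous, fun x hx m k hk hm hM => ?_, fun M j h hh hj hjM t ht => ?_⟩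
    · rw [abs_mul, abs_of_nonneg hK, mul_assoc]
      exact mul_le_mul_of_nonneg_left (hD.midpoint x hx m k hk hm hM) hK
    · rw [abs_mul, abs_of_nonneg hK, mul_assoc]
      exact mul_le_mul_of_nonneg_left (hD.discrete M j h hh hj hjM t ht) hK

/-- Assembling the residual of the scheme from the consistency errors in space and time. -/
theorem abs_residual_le {K₁ K₂ k h C₀ C₁ C₂ P' P Pt L' L E' E Em R' R F' F Fm Pf : ℝ}
    (hk : 0 ≤ k) (hC₀ : 0 ≤ C₀) (hC₁ : 0 ≤ C₁) (hC₂ : 0 ≤ C₂)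
    (hPf : Pf = Pt - K₁ * Em - K₂ * Fm) (b0 : |P' - P - 2 * k * Pt| ≤ C₀ * k ^ 3)
    (b1 : |K₁ * (E' + E - 2 * Em)| ≤ C₁ * k ^ 2) (b2 : |K₂ * (F' + F - 2 * Fm)| ≤ C₂ * k ^ 2)
    (d1' : |K₁ * (L' - E')| ≤ C₁ * h ^ 4) (d1 : |K₁ * (L - E)| ≤ C₁ * h ^ 4)
    (d2' : |K₂ * (R' - F')| ≤ C₂ * h ^ 4) (d2 : |K₂ * (R - F)| ≤ C₂ * h ^ 4) :
    |P' - K₁ * (2 * k) / 2 * L' - K₂ * (2 * k) / 2 * R'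
      - (P + K₁ * (2 * k) / 2 * L + K₂ * (2 * k) / 2 * R + 2 * k * Pf)|
      ≤ 2 * k * ((C₀ + C₁ * 2 + C₂ * 2) * ((2 * k) ^ 2 + h ^ 4)) := by
  -- Here `k = τ/2`. The residual is the midpoint error of `∂ₜu` minus `k` times six errors, three
  -- for each fractional term.
  have e : P' - K₁ * (2 * k) / 2 * L' - K₂ * (2 * k) / 2 * R'
      - (P + K₁ * (2 * k) / 2 * L + K₂ * (2 * k) / 2 * R + 2 * k * Pf)
      = (P' - P - 2 * k * Pt) - k * (K₁ * (L' - E') + K₁ * (L - E) + K₁ * (E' + E - 2 * Em)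
        + K₂ * (R' - F') + K₂ * (R - F) + K₂ * (F' + F - 2 * Fm)) := by
    rw [hPf]; ring
  have hB : |K₁ * (L' - E') + K₁ * (L - E) + K₁ * (E' + E - 2 * Em)
        + K₂ * (R' - F') + K₂ * (R - F) + K₂ * (F' + F - 2 * Fm)|
      ≤ 2 * (C₁ + C₂) * h ^ 4 + (C₁ + C₂) * k ^ 2 := by
    generalize K₁ * (L' - E') = B₁ at *
    generalize K₁ * (L - E) = B₂ at *
    generalize K₁ * (E' + E - 2 * Em) = B₃ at *
    generalize K₂ * (R' - F') = B₄ at *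
    generalize K₂ * (R - F) = B₅ at *
    generalize K₂ * (F' + F - 2 * Fm) = B₆ at *
    rw [abs_le] at *
    constructor <;> linarith
  have hkB := mul_le_mul_of_nonneg_left hB hk
  rw [← abs_of_nonneg hk, ← abs_mul, abs_of_nonneg hk] at hkB
  rw [e]
  refine (abs_sub _ _).trans ((add_le_add b0 hkB).trans ?_)
  have p1 : 0 ≤ C₀ * k ^ 3 := by positivity
  have p2 : 0 ≤ (C₁ + C₂) * k ^ 3 := by positivity
  have p3 : 0 ≤ k * h ^ 4 * C₀ := by positivity
  have p4 : 0 ≤ k * h ^ 4 * (C₁ + C₂) := by positivity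
  have e2 : 2 * k * ((C₀ + C₁ * 2 + C₂ * 2) * ((2 * k) ^ 2 + h ^ 4))
      = C₀ * k ^ 3 + k * (2 * (C₁ + C₂) * h ^ 4 + (C₁ + C₂) * k ^ 2)
        + (7 * (C₀ * k ^ 3) + 15 * ((C₁ + C₂) * k ^ 3) + 2 * (k * h ^ 4 * C₀)
          + 2 * (k * h ^ 4 * (C₁ + C₂))) := by ring
  rw [e2]
  linarith

end CNQuasiCompact
end

open CNQuasiCompact in
theorem mainTheorem1 (a b T α K₁ K₂ : ℝ) (hab : a < b) (hT : 0 < T)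
    (hα : 1 < α) (hα' : α ≤ 2) (hK₁ : 0 ≤ K₁) (hK₂ : 0 ≤ K₂) (hK : K₁ ^ 2 + K₂ ^ 2 ≠ 0)
    (f : ℝ → ℝ → ℝ)
    (hf : ContinuousOn (fun p : ℝ × ℝ => f p.1 p.2) (Set.Icc a b ×ˢ Set.Icc 0 T))
    (u₀ φa φb : ℝ → ℝ)
    (hφa : K₁ ≠ 0 → ∀ t ∈ Set.Icc 0 T, φa t = 0)
    (hφb : K₂ ≠ 0 → ∀ t ∈ Set.Icc 0 T, φb t = 0)
    (u : ℝ → ℝ → ℝ)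
    (hu : CNQuasiCompact.IsSolution a b T α K₁ K₂ f u₀ φa φb u)
    (hsmooth : CNQuasiCompact.IsSmoothSolution a b T K₁ K₂ u) :
    ∃ C : ℝ, ∀ (M N : ℕ) (h τ : ℝ) (U : ℕ → ℕ → ℝ), 1 ≤ M → 1 ≤ N →
      CNQuasiCompact.IsSchemeSolution a b T α K₁ K₂ f u₀ φa φb M N h τ U →
      ∀ n : ℕ, 1 ≤ n → n ≤ N →
        CNQuasiCompact.discreteNorm h M (fun j => u (a + j * h) (n * τ) - U n j)
          ≤ C * (τ ^ 2 + h ^ 4) := by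
  -- At least one coefficient is nonzero, and either smoothness hypothesis covers all of `[a,b] ×
  -- [0,T]`.
  obtain ⟨ut, C₀, hut⟩ : ∃ ut C, IsTimeConsistent a b T u ut C := by
    by_cases h1 : K₁ = 0
    · have h2 : K₂ ≠ 0 := fun h2 => hK (by rw [h1, h2]; norm_num)
      exact exists_isTimeConsistent Icc_subset_Ici_self
        ((uniqueDiffOn_Ici a).prod (uniqueDiffOn_Icc hT)) (hsmooth.right h2)
    · exact exists_isTimeConsistent Icc_subset_Iic_self
        ((uniqueDiffOn_Iic b).prod (uniqueDiffOn_Icc hT)) (hsmooth.left h1)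
  obtain ⟨D₁, C₁, hC₁, heq₁, hcont₁, hmid₁, hdisc₁⟩ := exists_scaled_consistency hK₁
    fun h => exists_isSpaceConsistent_left hab hT hα hα' (hsmooth.left h)
  obtain ⟨D₂, C₂, hC₂, heq₂, hcont₂, hmid₂, hdisc₂⟩ := exists_scaled_consistency hK₂
    fun h => exists_isSpaceConsistent_right hab hT hα hα' (hsmooth.right h)
  have hC₀ := hut.nonneg
  -- The equation is given only for interior `x`, but `P_x f` at `j = 1` and `j = M - 1` uses end
  -- values of `f`; it is extended to the closed interval by continuity.
  have hpde : ∀ t ∈ Ioc 0 T, ∀ x ∈ Icc a b,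
      f x t = ut x t - K₁ * D₁ x t - K₂ * D₂ x t := by
    intro t ht
    have ht' : t ∈ Icc 0 T := Ioc_subset_Icc_self ht
    have hcf : ContinuousOn (fun x => f x t) (Icc a b) :=
      hf.comp (f := fun x => (x, t)) (by fun_prop) fun x hx => ⟨hx, ht'⟩
    have hcr : ContinuousOn (fun x => ut x t - K₁ * D₁ x t - K₂ * D₂ x t) (Icc a b) :=
      ((hut.continuousOn t ht').sub (continuous_const.mul (hcont₁ t ht')).continuousOn).sub
        (continuous_const.mul (hcont₂ t ht')).continuousOn
    refine Set.EqOn.of_subset_closure (s := Ioo a b) (fun x hx => ?_) hcf hcr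
      Ioo_subset_Icc_self (closure_Ioo hab.ne).ge
    have h1 := (uniqueDiffOn_Icc hT t ht').eq_deriv _ (hu.equation x hx t ht)
      (hut.hasDerivWithinAt x (Ioo_subset_Icc_self hx) t ht')
    have h2 := heq₁ x hx t ht'
    have h3 := heq₂ x hx t ht'
    beta_reduce at h1 h2 h3 ⊢
    linarith
  -- `3` comes from stability, `√(b - a)` is `√M √h`, `T` bounds `nτ`, and the last factor is the
  -- residual constant.
  refine ⟨3 * √(b - a) * T * (C₀ + C₁ * 2 + C₂ * 2), fun M N h τ U hM hN hU n _ hn => ?_⟩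
  have hM0 : (0 : ℝ) < M := by exact_mod_cast hM
  have hN0 : (0 : ℝ) < N := by exact_mod_cast hN
  have hh0 : 0 < h := by rw [hU.space_step]; exact div_pos (by linarith) hM0
  have hτ0 : 0 < τ := by rw [hU.time_step]; exact div_pos hT hN0
  have hMh : M * h = b - a := by rw [hU.space_step]; field_simp
  have hNτ : N * τ = T := by rw [hU.time_step]; field_simp
  have hx : ∀ i ≤ M, a + (i : ℝ) * h ∈ Icc a b := fun i hi => by
    have h1 : (i : ℝ) ≤ M := by exact_mod_cast hi
    have h2 : (0 : ℝ) ≤ i := Nat.cast_nonneg i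
    exact ⟨by nlinarith, by nlinarith⟩
  have ht : ∀ n ≤ N, (n : ℝ) * τ ∈ Icc 0 T := fun n hn => by
    have h1 : (n : ℝ) ≤ N := by exact_mod_cast hn
    exact ⟨by positivity, by nlinarith⟩
  set v : ℕ → ℕ → ℝ := fun n i => u (a + i * h) (n * τ) with hv
  -- The scheme says nothing about indices beyond `M`, while the stability lemma wants zeros there.
  -- At `j = M` the cutoff changes nothing, by the boundary condition.
  set e : ℕ → ℕ → ℝ := fun n j => if j < M then v n j - U n j else 0 with he
  have heM : ∀ n ≤ N, ∀ j ≤ M, e n j = v n j - U n j := by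
    intro n hn j hj
    rcases hj.lt_or_eq with h1 | rfl
    · simp [he, h1]
    · have hb : a + (j : ℝ) * h = b := by linarith
      simp only [he, hv, lt_irrefl, if_false]
      rw [hb, hu.boundary_right _ (ht n hn), hU.boundary_right n hn, sub_self]
  set r : ℕ → ℕ → ℝ := fun n j =>
    Px α h (v (n + 1)) j - K₁ * τ / 2 * leftDiscrete α h (v (n + 1)) j
      - K₂ * τ / 2 * rightDiscrete α h M (v (n + 1)) j
    - (Px α h (v n) j + K₁ * τ / 2 * leftDiscrete α h (v n) j
      + K₂ * τ / 2 * rightDiscrete α h M (v n) j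
      + τ * Px α h (fun i => f (a + i * h) ((n + 1 / 2) * τ)) j) with hr
  set ρ : ℝ := τ * ((C₀ + C₁ * 2 + C₂ * 2) * (τ ^ 2 + h ^ 4)) with hρ
  have hρ0 : 0 ≤ ρ := by positivity
  have hrρ : ∀ n, n < N → ∀ j, 1 ≤ j → j < M → |r n j| ≤ ρ := by
    intro n hn j hj hjM
    set m : ℝ := (n + 1 / 2) * τ with hm
    set k : ℝ := τ / 2 with hk
    have hk0 : 0 ≤ k := by positivity
    have hmp : ((n + 1 : ℕ) : ℝ) * τ = m + k := by rw [hm, hk]; push_cast; ring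
    have hmm : (n : ℝ) * τ = m - k := by rw [hm, hk]; ring
    have t1 := ht (n + 1) (by omega)
    have t0 := ht n (by omega)
    rw [hmp] at t1
    rw [hmm] at t0
    -- The midpoint is positive even for `n = 0`, so the equation, given only for `t > 0`, is
    -- available there.
    have tm : m ∈ Ioc 0 T := ⟨by positivity, by linarith [t1.2]⟩
    have b0 : |Px α h (fun i => u (a + i * h) (m + k) - u (a + i * h) (m - k)
        - 2 * k * ut (a + i * h) m) j| ≤ C₀ * k ^ 3 :=
      abs_Px_le hα hα' hh0.ne' fun i hi => hut.midpoint _ (hx i (by omega)) m k hk0 t0.1 t1.2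
    have b1 : |Px α h (fun i => K₁ * (D₁ (a + i * h) (m + k) + D₁ (a + i * h) (m - k)
        - 2 * D₁ (a + i * h) m)) j| ≤ C₁ * k ^ 2 :=
      abs_Px_le hα hα' hh0.ne' fun i hi => hmid₁ _ (hx i (by omega)) m k hk0 t0.1 t1.2
    have b2 : |Px α h (fun i => K₂ * (D₂ (a + i * h) (m + k) + D₂ (a + i * h) (m - k)
        - 2 * D₂ (a + i * h) m)) j| ≤ C₂ * k ^ 2 :=
      abs_Px_le hα hα' hh0.ne' fun i hi => hmid₂ _ (hx i (by omega)) m k hk0 t0.1 t1.2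
    have d1p := hdisc₁ M j h hU.space_step hj hjM (m + k) t1
    have d1m := hdisc₁ M j h hU.space_step hj hjM (m - k) t0
    have d2p := hdisc₂ M j h hU.space_step hj hjM (m + k) t1
    have d2m := hdisc₂ M j h hU.space_step hj hjM (m - k) t0
    have hPf : Px α h (fun i => f (a + i * h) m) j
        = Px α h (fun i => ut (a + i * h) m - K₁ * D₁ (a + i * h) m - K₂ * D₂ (a + i * h) m) j :=
      Px_congr α h fun i hi => hpde m tm _ (hx i (by omega))
    simp only [Px_sub, Px_add, Px_const_mul] at b0 b1 b2 hPf
    have hτk : τ = 2 * k := by rw [hk]; ring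
    simp only [hr, hv, hρ]
    rw [hmp, hmm, ← hm, hτk]
    exact abs_residual_le hk0 hC₀ hC₁ hC₂ hPf b0 b1 b2 d1p d1m d2p d2m
  have hstab := sqrt_sum_sq_le_of_scheme hα hα' hh0 hτ0.le hK₁ hK₂ hρ0 M N e r
    (fun n j hj => by simp [he, not_lt.2 hj])
    (fun n hn => by
      rw [heM n hn 0 (by omega), hU.boundary_left n hn]
      simp only [hv, Nat.cast_zero, zero_mul, add_zero]
      rw [hu.boundary_left _ (ht n hn), sub_self])
    (fun j => by
      by_cases hj : j < M
      · rw [heM 0 (by omega) j hj.le, hU.initial j hj.le]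
        simp only [hv, Nat.cast_zero, zero_mul]
        rw [hu.initial _ (hx j hj.le), sub_self]
      · simp [he, hj])
    (fun n hn j hj hjM => by
      have hs := hU.equation n hn j hj hjM
      have c1 : ∀ i ≤ M, e (n + 1) i = v (n + 1) i - U (n + 1) i := heM (n + 1) (by omega)
      have c0 : ∀ i ≤ M, e n i = v n i - U n i := heM n (by omega)
      rw [Px_congr α h fun i hi => c1 i (by omega), Px_congr α h fun i hi => c0 i (by omega),
        leftDiscrete_congr α h fun i hi => c1 i (by omega),
        leftDiscrete_congr α h fun i hi => c0 i (by omega),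
        rightDiscrete_congr α h hj hjM.le c1, rightDiscrete_congr α h hj hjM.le c0]
      simp only [Px_sub, leftDiscrete_sub, rightDiscrete_sub, hr]
      linarith)
    hrρ n hn
  have hsum : ∑ j ∈ Finset.Ico 1 M, (u (a + j * h) (n * τ) - U n j) ^ 2
      = ∑ j ∈ Finset.Ico 1 M, e n j ^ 2 := by
    refine Finset.sum_congr rfl fun j hj => ?_
    rw [Finset.mem_Ico] at hj
    rw [heM n hn j hj.2.le]
  rw [discreteNorm, hsum, Real.sqrt_mul hh0.le]
  calc √h * √(∑ j ∈ Finset.Ico 1 M, e n j ^ 2) ≤ √h * (3 * n * (√M * ρ)) := by gcongr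
    _ = 3 * (√M * √h) * (n * τ) * ((C₀ + C₁ * 2 + C₂ * 2) * (τ ^ 2 + h ^ 4)) := by rw [hρ]; ring
    _ ≤ 3 * (√M * √h) * T * ((C₀ + C₁ * 2 + C₂ * 2) * (τ ^ 2 + h ^ 4)) := by
      gcongr
      exact (ht n hn).2
    _ = _ := by rw [← Real.sqrt_mul hM0.le, hMh]; ring
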